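/- **Setting.** Let $d\ge 1$, $m>0$, $\gamma\in(0,\tfrac12)$. For $p=(\tau,\xi)\in\mathbb R\times\mathbb R^{d-1}$ put $j(p)=(\tau^2-|\xi|^2-m^2)^{-\gamma}$ if $\tau>(|\xi|^2+m^2)^{1/2}$ and $j(p)=0$ otherwise. With $\mathcal F$ the unitary Fourier transform (kernel $(2\pi)^{-d/2}e^{-ix\cdot p}$), define for $f\in\mathcal S(\mathbb R^d\to\mathbb C)$ $$J^+f=\mathcal F^{-1}\big(j\,\mathcal F f\big),\qquad J^-f=\mathcal F\big(j\,\mathcal F^{-1}f\big),$$ so that the kernel of $J^-$ is the complex conjugate of that of $J^+$, and $$(\Re J^{+})f(y)=(2\pi)^{-d}\!\int\! j(p)\!\int\!\cos((x-y)\cdot p)f(x)\,dx\,dp,\qquad (\Im J^{+})f(y)=(2\pi)^{-d}\!\int\! j(p)\!\int\!\sin((x-y)\cdot p)f(x)\,dx\,dp .$$ Let $\mu$ be a probability measure on the Borel sets of the space $\mathcal S'(\mathbb R^d\to\mathbb R)$ of real tempered distributions $\phi$ such that, for all $g\in\mathcal S(\mathbb R^d\to\mathbb R)$, either $\int e^{i\langle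 g,\phi\rangle}d\mu(\phi)=e^{-\int|g|^2dx}$ (Gaussian field), or $\int e^{i\langle g,\phi\rangle}d\mu(\phi)=\exp\int_{\mathbb R^d}\int_{\mathbb R\setminus\{0\}}(e^{isg(x)}-1)M(ds)\,dx$ (Lévy field), where $M$ is a symmetric measure on $\mathbb R$ with $M(\{0\})=0$ and, for some $K$, $\int s^{2k}M(ds)<K^{2k}$ for all $k\ge1$ (the inner integral is understood symmetrically, as $\int(\cos(sg(x))-1)M(ds)$). For a function $F$ on $\mathbb R^d$ let $\langle F,\phi\rangle$ denote its stochastic extension: the random variable $X$ for which there are $v_k\in\mathcal S(\mathbb R^d\to\mathbb C)$ with $v_k\to F$ in $L^p(\mathbb R^d)$ and $\langle v_k,\phi\rangle\to X$ in $L^p(\mu)$ for every $p\in[2,\infty)$. Put $\psi^{+}(f)=\langle J^{+}f,\phi\rangle$ and $\psi^{-}(f)=\langle J^{-}f,\phi\rangle$. Let $D$ be the linear span of the random variables $c_0+\prod_{k=1}^N c_k\psi(f_k)$, each $\psi(f_k)$ being $\psi^+(f_k)$ or $\psi^-(f_k)$ with $c_0,c_k\in\mathbb C$ and $f_k\in\mathcal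 S(\mathbb R^d\to\mathbb C)$, and let $\mathcal H$ be the completion of $D$ (its closure in $L^2(\mu)$) for the inner product $\int u\bar v\,d\mu$. Set $\psi^{\cos}=\psi^++\psi^-$ and $\psi^{\sin}=i(\psi^+-\psi^-)$. **Theorem 2 (Main results, composed symmetric operators).** The stochastic extensions $\langle J^{\pm}f,\phi\rangle$, $\langle(\Re J^+)f,\phi\rangle$, $\langle(\Im J^+)f,\phi\rangle$ exist and are unique for every $f\in\mathcal S(\mathbb R^d\to\mathbb C)$, and $D\subset L^2(\mu)$. Moreover: i) $\psi^{\cos}$ is a generalized random field (complex linear in $f$ and continuous in mean square), and for every $f$, in particular for every real $f$, $\psi^{\cos}(f)=2\langle(\Re J^+)f,\phi\rangle$, which is written $2\langle f,\langle\Re J^+(\cdot),\phi\rangle\rangle$. Multiplication by $\psi^{\cos}(f)$ is an operator in $\mathcal H$ with domain $D$ that maps $D$ into $D$; for real valued $f$ it is symmetric (with dense domain $D$). It depends complex linearly on $f\in\mathcal S(\mathbb R^d\to\mathbb C)$. ii) The same holds for $\psi^{\sin}$, with $\psi^{\sin}(f)=2\langle(\Im J^+)f,\phi\rangle$. iii)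 For every complex valued $f\in\mathcal S(\mathbb R^d\to\mathbb C)$, multiplication by $\psi^{\pm}(f)=\psi^+(f)+\psi^-(\bar f)$ and by $\psi^{\mp}(f)=i(\psi^+(f)-\psi^-(\bar f))$ are symmetric operators in $\mathcal H$ with domain $D$, mapping $D$ into $D$, and they depend real linearly on $f$. -/

import Mathlib

open MeasureTheory Filter Topology
open scoped SchwartzMap FourierTransform ENNReal ComplexConjugate

noncomputable section

namespace LevyField

/-- Space-time `ℝ^d` of dimension `d = n + 1`, with coordinates `(t, x₁, …, xₙ)`; the coordinate
with index `0` is the time. -/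
abbrev Spacetime (n : ℕ) : Type := EuclideanSpace ℝ (Fin (n + 1))

/-- Complex test functions. -/
abbrev Test (n : ℕ) : Type := 𝓢(Spacetime n, ℂ)

/-- The space `𝓢'(ℝ^d → ℝ)` of real tempered distributions, with the weak-* topology. -/
abbrev RealDistribution (n : ℕ) : Type := 𝓢(Spacetime n, ℝ) →Lₚₜ[ℝ] ℝ

instance (n : ℕ) : MeasurableSpace (RealDistribution n) := borel _

instance (n : ℕ) : BorelSpace (RealDistribution n) := ⟨rfl⟩

/-! ### The underlying random field -/

/-- The centered Gaussian field: `∫ exp (i⟨g, φ⟩) dμ(φ) = exp (-∫ |g|²)`. -/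
def IsGaussianField {n : ℕ} (μ : Measure (RealDistribution n)) : Prop :=
  ∀ g : 𝓢(Spacetime n, ℝ),
    ∫ φ, Complex.exp (Complex.I * ((φ g : ℝ) : ℂ)) ∂μ
      = Complex.exp (((-∫ x, |g x| ^ 2 : ℝ)) : ℂ)

/-- Symmetric measures `M` on `ℝ` (without charge at the origin) such that, for some `K`,
`∫ s^{2k} M(ds) < K^{2k}` for all `k ≥ 1`.  By symmetry the odd moments vanish. -/
structure IsAdmissibleLevyMeasure (M : Measure ℝ) : Prop where
  zero_singleton : M {0} = 0
  symm : M.map (fun s => -s) = M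
  moments : ∃ K : ℝ, ∀ k : ℕ, 1 ≤ k →
    ∫⁻ s, ENNReal.ofReal (s ^ (2 * k)) ∂M < ENNReal.ofReal (K ^ (2 * k))

/-- The exponent `∫_{ℝ∖{0}} (e^{isy} - 1) M(ds)` for a symmetric measure `M`.  The odd part
`i sin (sy)` of the integrand cancels, and the integral is understood in this symmetric sense, in
which it converges absolutely as soon as `∫ s² M(ds) < ∞` (see `levyExponent_eq`). -/
def levyExponent (M : Measure ℝ) (y : ℝ) : ℝ :=
  ∫ s in ({0}ᶜ : Set ℝ), (Real.cos (s * y) - 1) ∂M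

/-- The Lévy field with Lévy measure `M(ds) × dx`:
`∫ exp (i⟨g, φ⟩) dμ(φ) = exp (∫ ∫ (e^{is g(x)} - 1) M(ds) dx)`. -/
def IsLevyField {n : ℕ} (M : Measure ℝ) (μ : Measure (RealDistribution n)) : Prop :=
  ∀ g : 𝓢(Spacetime n, ℝ),
    ∫ φ, Complex.exp (Complex.I * ((φ g : ℝ) : ℂ)) ∂μ
      = Complex.exp (((∫ x, levyExponent M (g x) : ℝ)) : ℂ)

/-- Whenever `∫ (e^{isy} - 1) M(ds)` converges absolutely it equals `levyExponent M y`. -/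
theorem levyExponent_eq {M : Measure ℝ} (hM : M.map (fun s => -s) = M) (y : ℝ)
    (hint : IntegrableOn (fun s : ℝ => Complex.exp (Complex.I * (s : ℂ) * (y : ℂ)) - 1)
      ({0}ᶜ : Set ℝ) M) :
    ∫ s in ({0}ᶜ : Set ℝ), (Complex.exp (Complex.I * (s : ℂ) * (y : ℂ)) - 1) ∂M
      = ((levyExponent M y : ℝ) : ℂ) := by
  have hemb : MeasurableEmbedding (fun s : ℝ => -s) := (MeasurableEquiv.neg ℝ).measurableEmbedding
  have hpre : (fun s : ℝ => -s) ⁻¹' ({0}ᶜ : Set ℝ) = {0}ᶜ := by ext s; simp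
  have hmap : (M.restrict {0}ᶜ).map (fun s : ℝ => -s) = M.restrict {0}ᶜ := by
    conv_rhs => rw [← hM]
    rw [hemb.restrict_map, hpre]
  set F : ℝ → ℂ := fun s => Complex.exp (Complex.I * (s : ℂ) * (y : ℂ)) - 1 with hF
  have hint' : Integrable (fun s => F (-s)) (M.restrict {0}ᶜ) := by
    have h := hint
    rw [IntegrableOn, ← hmap, hemb.integrable_map_iff] at h
    exact h
  have hneg : ∫ s in ({0}ᶜ : Set ℝ), F (-s) ∂M = ∫ s in ({0}ᶜ : Set ℝ), F s ∂M := by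
    conv_rhs => rw [← hmap]
    rw [hemb.integral_map]
  have hsum : ∀ s : ℝ, F s + F (-s) = 2 * ((Real.cos (s * y) - 1 : ℝ) : ℂ) := by
    intro s
    simp only [hF]
    push_cast
    rw [show Complex.I * (s : ℂ) * (y : ℂ) = ((s : ℂ) * y) * Complex.I by ring,
      show Complex.I * (-(s : ℂ)) * (y : ℂ) = (-((s : ℂ) * y)) * Complex.I by ring,
      Complex.exp_mul_I, Complex.exp_mul_I, Complex.cos_neg, Complex.sin_neg]
    ring
  have h2 : 2 * ∫ s in ({0}ᶜ : Set ℝ), F s ∂M = 2 * ((levyExponent M y : ℝ) : ℂ) := by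
    rw [two_mul]
    nth_rewrite 2 [← hneg]
    rw [← integral_add hint hint']
    simp only [hsum]
    rw [integral_const_mul, levyExponent, integral_complex_ofReal]
  exact mul_left_cancel₀ two_ne_zero h2

/-! ### The pseudo-differential operators -/

/-- The symbol `(τ² - (|ξ|² + m²))^{-γ}` on `τ > (|ξ|² + m²)^{1/2}`, and `0` elsewhere. -/
def symbol {n : ℕ} (m γ : ℝ) (p : Spacetime n) : ℝ :=
  if Real.sqrt ((∑ k : Fin n, p k.succ ^ 2) + m ^ 2) < p 0 then
    (p 0 ^ 2 - ((∑ k : Fin n, p k.succ ^ 2) + m ^ 2)) ^ (-γ)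
  else 0

/-- `J⁺ f = F⁻¹ (j · F f)`.  Mathlib's Fourier transform has the kernel `e^{-2πi x·p}`, so the
angular momentum variable, in which the symbol `j` is given, is `2πp`. -/
def Jplus {n : ℕ} (m γ : ℝ) (f : Test n) : Spacetime n → ℂ :=
  𝓕⁻ (fun p : Spacetime n => (symbol m γ ((2 * Real.pi) • p) : ℂ) * 𝓕 (f : Spacetime n → ℂ) p)

/-- `J⁻ f = F (j · F⁻¹ f)`, the operator whose kernel is the complex conjugate of that of `J⁺`. -/
def Jminus {n : ℕ} (m γ : ℝ) (f : Test n) : Spacetime n → ℂ :=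
  𝓕 (fun p : Spacetime n => (symbol m γ ((2 * Real.pi) • p) : ℂ) * 𝓕⁻ (f : Spacetime n → ℂ) p)

/-- The operator `Re J⁺(·)` with (oscillatory) kernel `(2π)^{-d} ∫ cos ((x - y)·p) j(p) dp`, `x`
being the variable of the test function; `p` is replaced by `2πp` in the outer integral. -/
def reJ {n : ℕ} (m γ : ℝ) (f : Test n) (y : Spacetime n) : ℂ :=
  ∫ p : Spacetime n, (symbol m γ ((2 * Real.pi) • p) : ℂ) *
    ∫ x : Spacetime n, (Real.cos (2 * Real.pi * inner ℝ (x - y) p) : ℂ) * f x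

/-- The operator `Im J⁺(·)` with (oscillatory) kernel `(2π)^{-d} ∫ sin ((x - y)·p) j(p) dp`, `x`
being the variable of the test function; `p` is replaced by `2πp` in the outer integral. -/
def imJ {n : ℕ} (m γ : ℝ) (f : Test n) (y : Spacetime n) : ℂ :=
  ∫ p : Spacetime n, (symbol m γ ((2 * Real.pi) • p) : ℂ) *
    ∫ x : Spacetime n, (Real.sin (2 * Real.pi * inner ℝ (x - y) p) : ℂ) * f x

/-! ### Stochastic extension of the dual pairing -/

/-- The complex-bilinear pairing `⟨v, φ⟩ = ⟨Re v, φ⟩ + i ⟨Im v, φ⟩` of a complex test function with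
a real distribution. -/
def pairing {n : ℕ} (v : Test n) (φ : RealDistribution n) : ℂ :=
  ((φ (v.postcompCLM Complex.reCLM) : ℝ) : ℂ)
    + Complex.I * ((φ (v.postcompCLM Complex.imCLM) : ℝ) : ℂ)

/-- `X` is a stochastic extension of the pairing of `F` with the field: there is one sequence of
test functions `v k` with `v k → F` in `L^p(ℝ^d)` and `⟨v k, φ⟩ → X` in `L^p(μ)`, for all
`p ∈ [2, ∞)`. -/
def IsStochasticExtension {n : ℕ} (μ : Measure (RealDistribution n)) (F : Spacetime n → ℂ)
    (X : RealDistribution n →ₘ[μ] ℂ) : Prop :=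
  ∃ v : ℕ → Test n, ∀ p : ℝ≥0∞, 2 ≤ p → p ≠ ∞ →
    Tendsto (fun k => eLpNorm (fun x => v k x - F x) p volume) atTop (𝓝 0) ∧
    Tendsto (fun k => eLpNorm (fun φ => pairing (v k) φ - X φ) p μ) atTop (𝓝 0)

open Classical in
/-- The random variable `⟨F, φ⟩`, defined by stochastic extension (and `0` if there is none). -/
def extPairing {n : ℕ} (μ : Measure (RealDistribution n)) (F : Spacetime n → ℂ) :
    RealDistribution n →ₘ[μ] ℂ :=
  if h : ∃ X, IsStochasticExtension μ F X then h.choose else 0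

/-! ### The fields -/

section Fields

variable {n : ℕ} (m γ : ℝ) (μ : Measure (RealDistribution n))

/-- `ψ⁺(f) = ⟨J⁺ f, φ⟩`. -/
def psiPlus (f : Test n) : RealDistribution n →ₘ[μ] ℂ := extPairing μ (Jplus m γ f)

/-- `ψ⁻(f) = ⟨J⁻ f, φ⟩`. -/
def psiMinus (f : Test n) : RealDistribution n →ₘ[μ] ℂ := extPairing μ (Jminus m γ f)

/-- The random field `⟨f, ⟨Re J⁺(·), φ⟩⟩ = ⟨(Re J⁺) f, φ⟩`. -/
def reField (f : Test n) : RealDistribution n →ₘ[μ] ℂ := extPairing μ (reJ m γ f)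

/-- The random field `⟨f, ⟨Im J⁺(·), φ⟩⟩ = ⟨(Im J⁺) f, φ⟩`. -/
def imField (f : Test n) : RealDistribution n →ₘ[μ] ℂ := extPairing μ (imJ m γ f)

/-- `ψ^cos = ψ⁺ + ψ⁻`. -/
def psiCos (f : Test n) : RealDistribution n →ₘ[μ] ℂ := psiPlus m γ μ f + psiMinus m γ μ f

/-- `ψ^sin = i (ψ⁺ - ψ⁻)`. -/
def psiSin (f : Test n) : RealDistribution n →ₘ[μ] ℂ :=
  Complex.I • (psiPlus m γ μ f - psiMinus m γ μ f)

/-- The complex conjugate of a test function. -/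
def conjTest (f : Test n) : Test n :=
  f.postcompCLM (Complex.conjCLE : ℂ →L[ℝ] ℂ)

/-- `ψ^±(f) = ψ⁺(f) + ψ⁻(f̄)`. -/
def psiPM (f : Test n) : RealDistribution n →ₘ[μ] ℂ :=
  psiPlus m γ μ f + psiMinus m γ μ (conjTest f)

/-- `ψ^∓(f) = i (ψ⁺(f) - ψ⁻(f̄))`. -/
def psiMP (f : Test n) : RealDistribution n →ₘ[μ] ℂ :=
  Complex.I • (psiPlus m γ μ f - psiMinus m γ μ (conjTest f))

/-! ### The physical Hilbert space and multiplication operators -/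

/-- The linear space `D` of random variables spanned by the `c₀ + ∏ₖ cₖ ψ(fₖ)`, where each `ψ(fₖ)`
is `ψ⁺(fₖ)` or `ψ⁻(fₖ)`. -/
def polySpace : Submodule ℂ (RealDistribution n →ₘ[μ] ℂ) :=
  Submodule.span ℂ {u | ∃ (c₀ : ℂ) (N : ℕ) (c : Fin N → ℂ)
    (X : Fin N → (RealDistribution n →ₘ[μ] ℂ)),
    (∀ k, ∃ f : Test n, X k = psiPlus m γ μ f ∨ X k = psiMinus m γ μ f) ∧
    u = AEEqFun.const (RealDistribution n) c₀ + ∏ k, c k • X k}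

/-- The inclusion of `L²(μ)` into the space of all random variables. -/
def lpIncl : Lp ℂ 2 μ →ₗ[ℂ] (RealDistribution n →ₘ[μ] ℂ) where
  toFun u := u
  map_add' _ _ := rfl
  map_smul' _ _ := rfl

theorem lpIncl_injective : Function.Injective (lpIncl μ) := Subtype.coe_injective

/-- The Hilbert space `ℋ`, the completion of `D` for the inner product `∫ u v̄ dμ`, realized as the
closure of `D` in `L²(μ)`. -/
def hilbert : Submodule ℂ (Lp ℂ 2 μ) :=
  ((polySpace m γ μ).comap (lpIncl μ)).topologicalClosure

/-- `D` as a subspace of `ℋ`. -/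
def fieldDomain : Submodule ℂ (hilbert m γ μ) :=
  (polySpace m γ μ).comap (lpIncl μ ∘ₗ (hilbert m γ μ).subtype)

theorem mul_add_aux (X u v : RealDistribution n →ₘ[μ] ℂ) :
    X * (u + v) = X * u + X * v := by
  apply AEEqFun.ext
  filter_upwards [AEEqFun.coeFn_mul X (u + v), AEEqFun.coeFn_add u v,
    AEEqFun.coeFn_add (X * u) (X * v), AEEqFun.coeFn_mul X u, AEEqFun.coeFn_mul X v]
    with φ h1 h2 h3 h4 h5
  simp only [h1, h2, h3, h4, h5, Pi.mul_apply, Pi.add_apply, mul_add]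

theorem mul_smul_aux (c : ℂ) (X u : RealDistribution n →ₘ[μ] ℂ) :
    X * (c • u) = c • (X * u) := by
  apply AEEqFun.ext
  filter_upwards [AEEqFun.coeFn_mul X (c • u), AEEqFun.coeFn_smul c u,
    AEEqFun.coeFn_smul c (X * u), AEEqFun.coeFn_mul X u] with φ h1 h2 h3 h4
  simp only [h1, h2, h3, h4, Pi.mul_apply, Pi.smul_apply, mul_smul_comm]

/-- The `u ∈ D` for which `X u` lies in `ℋ`. -/
def mulDomain (X : RealDistribution n →ₘ[μ] ℂ) : Submodule ℂ (hilbert m γ μ) where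
  carrier := {u | u ∈ fieldDomain m γ μ ∧
    ∃ w : hilbert m γ μ, lpIncl μ (w : Lp ℂ 2 μ) = X * lpIncl μ (u : Lp ℂ 2 μ)}
  add_mem' := by
    rintro u v ⟨hu, w, hw⟩ ⟨hv, z, hz⟩
    refine ⟨add_mem hu hv, w + z, ?_⟩
    rw [Submodule.coe_add, Submodule.coe_add, map_add, map_add, mul_add_aux, hw, hz]
  zero_mem' := by
    refine ⟨zero_mem _, 0, ?_⟩
    have h := mul_smul_aux μ 0 X (0 : RealDistribution n →ₘ[μ] ℂ)
    rw [zero_smul ℂ (X * 0), zero_smul ℂ (0 : RealDistribution n →ₘ[μ] ℂ)] at h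
    rw [Submodule.coe_zero, map_zero, h]
  smul_mem' := by
    rintro c u ⟨hu, w, hw⟩
    refine ⟨Submodule.smul_mem _ c hu, c • w, ?_⟩
    rw [Submodule.coe_smul, Submodule.coe_smul, map_smul, map_smul, mul_smul_aux, hw]

/-- The vector `X u` of `ℋ`. -/
def mulValue (X : RealDistribution n →ₘ[μ] ℂ) (u : mulDomain m γ μ X) : hilbert m γ μ :=
  u.2.2.choose

theorem lpIncl_mulValue (X : RealDistribution n →ₘ[μ] ℂ) (u : mulDomain m γ μ X) :
    lpIncl μ (mulValue m γ μ X u : Lp ℂ 2 μ)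
      = X * lpIncl μ ((u : hilbert m γ μ) : Lp ℂ 2 μ) :=
  u.2.2.choose_spec

/-- The operator of multiplication by the random variable `X` in `ℋ`, defined on those `u ∈ D` for
which `X u ∈ ℋ`. -/
def mulOperator (X : RealDistribution n →ₘ[μ] ℂ) :
    hilbert m γ μ →ₗ.[ℂ] hilbert m γ μ where
  domain := mulDomain m γ μ X
  toFun :=
    { toFun := mulValue m γ μ X
      map_add' := by
        intro u v
        apply Subtype.ext
        apply lpIncl_injective μ
        rw [Submodule.coe_add, map_add, lpIncl_mulValue, lpIncl_mulValue, lpIncl_mulValue,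
          Submodule.coe_add, Submodule.coe_add, map_add, mul_add_aux]
      map_smul' := by
        intro c u
        apply Subtype.ext
        apply lpIncl_injective μ
        rw [RingHom.id_apply, Submodule.coe_smul, map_smul, lpIncl_mulValue, lpIncl_mulValue,
          Submodule.coe_smul, Submodule.coe_smul, map_smul, mul_smul_aux] }

end Fields

/-- A generalized random field on `ℝ^d`: a complex-linear map from test functions to random
variables that is continuous in mean square. -/
def IsRandomField {n : ℕ} {μ : Measure (RealDistribution n)}
    (Z : Test n → (RealDistribution n →ₘ[μ] ℂ)) : Prop :=
  (∀ f g, Z (f + g) = Z f + Z g) ∧ (∀ (c : ℂ) f, Z (c • f) = c • Z f) ∧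
  ∀ f, Tendsto (fun g => eLpNorm (Z g - Z f) 2 μ) (𝓝 f) (𝓝 0)

/-- Densely defined symmetric operators. -/
def IsSymmetricOperator {H : Type*} [NormedAddCommGroup H] [InnerProductSpace ℂ H]
    (T : H →ₗ.[ℂ] H) : Prop :=
  Dense (T.domain : Set H) ∧ T.IsFormalAdjoint T

/-- `D` is exactly the domain of `T`, and `T` maps `D` into `D`. -/
def ActsOn {H : Type*} [NormedAddCommGroup H] [InnerProductSpace ℂ H]
    (D : Submodule ℂ H) (T : H →ₗ.[ℂ] H) : Prop :=
  T.domain = D ∧ ∀ u : T.domain, T u ∈ D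

end LevyField

end

/-!
The singularity of the symbol `j` on the mass shell is of order `s ^ (-γ)` in the distance `s` to the
shell, so `2γ < 1` makes `j` square integrable against a power weight
(`memLp_symbol_mul_weight`).  Hence `j · F f ∈ L¹ ∩ L²` for a test function `f`, and approximating it
there by test functions gives, after inverse Fourier transformation, test functions that converge to
`J⁺ f` in `L²` with uniformly bounded errors (`exists_seq_test_fourierInv`); bounded errors that tend
to zero in `L²` do so in every `L^p`, `2 ≤ p < ∞`.

On the probabilistic side the characteristic functional along a real test function `g` is
`t ↦ exp (L t)` with an entire function `L`, which is the cumulant series of `⟨g, φ⟩`; on the unit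
circle `L` is at most `K² ‖g‖₂² cosh (K ‖g‖_∞)` (`exists_hasEntireExponent`).  A characteristic
function that extends to an entire function has all moments: second differences at the origin and
Fatou's lemma pass from order `2N` to `2N + 2` (`memLp_of_charFun_entire`).  Cauchy's estimate then
bounds the moment of order `2N` by `(2N)! (exp (sup |L|) - 1)`
(`lintegral_pow_le_of_charFun_eq_exp`), which tends to zero with `‖g‖₂` as long as `‖g‖_∞` stays
bounded, while the second moment is at most `K² ‖g‖₂²` (`lintegral_sq_le_of_charFun`).

Together these give existence of the stochastic extensions (`exists_isStochasticExtension`); the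
second moment bound gives uniqueness, linearity in `f`, and continuity in mean square.  Uniqueness
also yields `ψ⁻(f) = conj ψ⁺(f̄)`, so that `ψ^±(f)` and `ψ^∓(f)`, and for real `f` also `ψ^cos(f)` and
`ψ^sin(f)`, are real random variables.  All `ψ(f)` have moments of every order, so by Hölder's
inequality `D ⊂ L²(μ)`; since `D` is closed under multiplication by the fields, multiplication by a
real one is a symmetric operator with domain `D`.
-/

noncomputable section

namespace LevyField

/-! ### Moments from an entire characteristic function -/

theorem two_mul_one_sub_cos_div (x : ℝ) {t : ℝ} (ht : t ≠ 0) :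
    2 * (1 - Real.cos (t * x)) / t ^ 2 = x ^ 2 * Real.sinc (t * x / 2) ^ 2 := by
  have h : Real.cos (t * x) = 1 - 2 * Real.sin (t * x / 2) ^ 2 := by
    rw [Real.sin_sq_eq_half_sub]; ring_nf
  rcases eq_or_ne x 0 with rfl | hx
  · simp
  · rw [Real.sinc_of_ne_zero (by positivity), h]
    field_simp
    ring

/-- A second moment is controlled by second differences at the origin of the corresponding Fourier
integral: `2 (1 - cos (t x)) / t² → x²` as `t → 0`, and Fatou's lemma applies. -/
theorem lintegral_mul_sq_le {ν : Measure ℝ} {w : ℝ → ℝ} (hw : Measurable w) {C : ℝ}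
    (h : ∀ t : ℝ, 0 < t → t ≤ 1 →
      ∫⁻ x, ENNReal.ofReal (w x * (2 * (1 - Real.cos (t * x)))) ∂ν ≤ ENNReal.ofReal (C * t ^ 2)) :
    ∫⁻ x, ENNReal.ofReal (w x * x ^ 2) ∂ν ≤ ENNReal.ofReal C := by
  set t : ℕ → ℝ := fun n => 1 / ((n : ℝ) + 1) with ht
  have ht0 : ∀ n, 0 < t n := fun n => Nat.one_div_pos_of_nat
  have ht1 : ∀ n, t n ≤ 1 := fun n => by
    rw [ht]; simp only
    rw [div_le_one (by positivity)]
    linarith [(Nat.cast_nonneg n : (0 : ℝ) ≤ n)]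
  have htl : Tendsto t atTop (𝓝 0) := tendsto_one_div_add_atTop_nhds_zero_nat
  set F : ℕ → ℝ → ℝ≥0∞ := fun n x =>
    ENNReal.ofReal (w x * (2 * (1 - Real.cos (t n * x)) / t n ^ 2)) with hF
  have hlim : ∀ x, Tendsto (fun n => F n x) atTop (𝓝 (ENNReal.ofReal (w x * x ^ 2))) := by
    intro x
    refine (ENNReal.continuous_ofReal.tendsto _).comp ?_
    have h2 : Tendsto (fun n => w x * (x ^ 2 * Real.sinc (t n * x / 2) ^ 2)) atTop
        (𝓝 (w x * (x ^ 2 * Real.sinc (0 * x / 2) ^ 2))) := by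
      have : Continuous fun s : ℝ => w x * (x ^ 2 * Real.sinc (s * x / 2) ^ 2) := by fun_prop
      exact (this.tendsto 0).comp htl
    simp only [zero_mul, zero_div, Real.sinc_zero, one_pow, mul_one] at h2
    refine h2.congr fun n => ?_
    rw [two_mul_one_sub_cos_div x (ht0 n).ne']
  have hbound : ∀ n, ∫⁻ x, F n x ∂ν ≤ ENNReal.ofReal C := by
    intro n
    have e : ∀ x, F n x = ENNReal.ofReal (1 / t n ^ 2) *
        ENNReal.ofReal (w x * (2 * (1 - Real.cos (t n * x)))) := by
      intro x
      rw [← ENNReal.ofReal_mul (by positivity)]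
      simp only [hF]
      congr 1; ring
    simp only [e]
    rw [lintegral_const_mul _ (by fun_prop)]
    refine (mul_le_mul_right (h (t n) (ht0 n) (ht1 n)) _).trans ?_
    rw [← ENNReal.ofReal_mul (by positivity)]
    refine le_of_eq ?_
    congr 1
    have := (ht0 n).ne'
    field_simp
  calc ∫⁻ x, ENNReal.ofReal (w x * x ^ 2) ∂ν = ∫⁻ x, liminf (fun n => F n x) atTop ∂ν := by
        refine lintegral_congr fun x => ((hlim x).liminf_eq).symm
    _ ≤ liminf (fun n => ∫⁻ x, F n x ∂ν) atTop := lintegral_liminf_le fun n => by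
        simp only [hF]; fun_prop
    _ ≤ ENNReal.ofReal C := by
        refine (liminf_le_liminf (Eventually.of_forall hbound)).trans ?_
        simp

theorem iteratedDeriv_comp_ofReal {H : ℂ → ℂ} (hH : Differentiable ℂ H) (k : ℕ) :
    iteratedDeriv k (fun t : ℝ => H t) = fun t : ℝ => iteratedDeriv k H t := by
  induction k with
  | zero => simp
  | succ k ih =>
    rw [iteratedDeriv_succ, ih]
    ext t
    have hd : Differentiable ℂ (iteratedDeriv k H) :=
      (hH.contDiff (n := (k + 1 : ℕ))).differentiable_iteratedDeriv k (by norm_cast; simp)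
    rw [iteratedDeriv_succ]
    exact ((hd t).hasDerivAt.comp_ofReal).deriv

/-- Second differences of a function of class `C²` are of second order. -/
theorem exists_norm_second_difference_le {G : ℂ → ℂ} (hG : Differentiable ℂ G) :
    ∃ C : ℝ, ∀ t : ℝ, 0 < t → t ≤ 1 →
      ‖2 * G 0 - G (t : ℝ) - G ((-t : ℝ) : ℂ)‖ ≤ C * t ^ 2 := by
  have hD : Differentiable ℂ (deriv G) := hG.deriv
  have hDc : Continuous (deriv (deriv G)) := hD.deriv.continuous
  obtain ⟨C, hC⟩ := (isCompact_closedBall (0 : ℂ) 1).exists_bound_of_continuousOn hDc.continuousOn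
  have h1 : ∀ s : ℝ, 0 ≤ s → s ≤ 1 →
      ‖deriv G (s : ℂ) - deriv G (-(s : ℂ))‖ ≤ C * (2 * s) := by
    intro s hs hs1
    have := (convex_closedBall (0 : ℂ) 1).norm_image_sub_le_of_norm_deriv_le
      (f := deriv G) (x := -(s : ℂ)) (y := s) (C := C) (fun x _ => hD x) hC
      (by simpa [abs_of_nonneg hs] using hs1) (by simpa [abs_of_nonneg hs] using hs1)
    refine this.trans (le_of_eq ?_)
    rw [sub_neg_eq_add, ← two_mul, norm_mul]
    simp [abs_of_nonneg hs]
  have hC0 : 0 ≤ C := (norm_nonneg _).trans (hC 0 (by simp))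
  refine ⟨2 * C, fun t ht ht1 => ?_⟩
  set φ : ℝ → ℂ := fun s => 2 * G 0 - G (s : ℝ) - G ((-s : ℝ) : ℂ) with hφ
  have hder : ∀ s : ℝ, HasDerivAt φ (-(deriv G (s : ℂ) - deriv G (-(s : ℂ)))) s := by
    intro s
    have a := ((hG (s : ℂ)).hasDerivAt).comp_ofReal
    have b : HasDerivAt (fun s : ℝ => G ((-s : ℝ) : ℂ)) (-deriv G (-(s : ℂ))) s := by
      have := ((hG ((-s : ℝ) : ℂ)).hasDerivAt).comp_ofReal
      have h2 := this.scomp s (hasDerivAt_neg s)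
      simpa [Function.comp_def] using h2
    have := (a.const_sub (2 * G 0)).sub b
    exact this.congr_deriv (by ring)
  have := (convex_Icc (0 : ℝ) t).norm_image_sub_le_of_norm_deriv_le
      (f := φ) (x := 0) (y := t) (C := C * (2 * t)) (fun x _ => (hder x).differentiableAt)
      (fun x hx => by
        rw [(hder x).deriv, norm_neg]
        refine (h1 x hx.1 (hx.2.trans ht1)).trans ?_
        have := hx.2
        gcongr)
      (by simp [ht.le]) (by simp [ht.le])
  have h0 : φ 0 = 0 := by simp [hφ]; ring
  rw [h0, sub_zero, sub_zero, Real.norm_of_nonneg ht.le] at this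
  refine this.trans (le_of_eq (by ring))

theorem memLp_id_even_iff {ν : Measure ℝ} {N : ℕ} (hN : N ≠ 0) :
    MemLp (id : ℝ → ℝ) ((2 * N : ℕ) : ℝ≥0∞) ν ↔
      ∫⁻ x, ENNReal.ofReal (x ^ (2 * N)) ∂ν < ∞ := by
  rw [MemLp, and_iff_right (by fun_prop), eLpNorm_lt_top_iff_lintegral_rpow_enorm_lt_top
    (by simpa using hN) (ENNReal.natCast_ne_top _)]
  simp only [ENNReal.toReal_natCast, ENNReal.rpow_natCast, id]
  refine iff_of_eq (congrArg (· < ∞) (lintegral_congr fun x => ?_))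
  rw [← ofReal_norm, ← ENNReal.ofReal_pow (norm_nonneg _), Real.norm_eq_abs,
    pow_mul, sq_abs, ← pow_mul]

theorem exp_mul_I_add_exp_neg_mul_I (t x : ℝ) : Complex.exp (t * x * Complex.I) + Complex.exp (-t * x * Complex.I)
    = 2 * Real.cos (t * x) := by
  push_cast
  rw [Complex.exp_mul_I, Complex.exp_mul_I, neg_mul, Complex.cos_neg, Complex.sin_neg]
  ring

section

variable {ν : Measure ℝ} [IsProbabilityMeasure ν] {H : ℂ → ℂ}

/-- The moment of order `2N` against second differences of the exponential, expressed by the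
derivative of order `2N` of the characteristic function. -/
theorem integral_pow_mul_one_sub_cos (hH : Differentiable ℂ H)
    (hchar : ∀ t : ℝ, charFun ν t = H t) {N : ℕ} (hmem : MemLp id ((2 * N : ℕ) : ℝ≥0∞) ν) (t : ℝ) :
    ((∫ x, x ^ (2 * N) * (2 * (1 - Real.cos (t * x))) ∂ν : ℝ) : ℂ) =
      (-1) ^ N * (2 * iteratedDeriv (2 * N) H 0 - iteratedDeriv (2 * N) H (t : ℝ)
        - iteratedDeriv (2 * N) H ((-t : ℝ) : ℂ)) := by
  have hfun : charFun ν = fun t : ℝ => H t := funext hchar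
  have key : ∀ s : ℝ, iteratedDeriv (2 * N) H (s : ℂ)
      = (-1) ^ N * ∫ x : ℝ, (x : ℂ) ^ (2 * N) * Complex.exp (s * x * Complex.I) ∂ν := by
    intro s
    have h1 := iteratedDeriv_charFun (t := s) hmem
    rw [hfun, iteratedDeriv_comp_ofReal hH, pow_mul, Complex.I_sq] at h1
    exact h1
  have hint0 : Integrable (fun x : ℝ => x ^ (2 * N)) ν := by
    have := hmem.integrable_norm_pow'
    simpa [abs_pow, pow_mul, sq_abs] using this
  have hint : ∀ s : ℝ,
      Integrable (fun x : ℝ => (x : ℂ) ^ (2 * N) * Complex.exp (s * x * Complex.I)) ν := by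
    intro s
    refine (hint0.ofReal (𝕜 := ℂ)).norm.mono' (by fun_prop) (Eventually.of_forall fun x => ?_)
    rw [norm_mul, ← Complex.ofReal_mul, Complex.norm_exp_ofReal_mul_I, mul_one]
    simp
  have hsgn : ((-1 : ℂ) ^ N) * (-1) ^ N = 1 := by rw [← mul_pow]; simp
  have k0 := key 0
  rw [Complex.ofReal_zero] at k0
  rw [k0, key t, key (-t), ← integral_complex_ofReal]
  have : ∀ a b c : ℂ, (-1) ^ N * (2 * ((-1) ^ N * a) - (-1) ^ N * b - (-1) ^ N * c)
      = 2 * a - b - c := by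
    intro a b c
    linear_combination (2 * a - b - c) * hsgn
  rw [this, ← integral_const_mul, ← integral_sub, ← integral_sub]
  · refine integral_congr_ae (Eventually.of_forall fun x => ?_)
    have := exp_mul_I_add_exp_neg_mul_I t x
    simp only
    push_cast at this ⊢
    rw [zero_mul, zero_mul, Complex.exp_zero]
    linear_combination (x : ℂ) ^ (2 * N) * this
  · have h0 := hint 0
    rw [Complex.ofReal_zero] at h0
    exact (h0.const_mul 2).sub (hint t)
  · exact hint (-t)
  · have h0 := hint 0
    rw [Complex.ofReal_zero] at h0
    exact (h0.const_mul 2)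
  · exact hint t

/-- A probability measure on `ℝ` whose characteristic function is the restriction of an entire
function has all moments: by induction on `N`, the derivative of order `2N` of the characteristic
function is the Fourier integral of `x^(2N)`, whose second differences bound the next even moment. -/
theorem memLp_of_charFun_entire (hH : Differentiable ℂ H)
    (hchar : ∀ t : ℝ, charFun ν t = H t) (N : ℕ) : MemLp id ((2 * N : ℕ) : ℝ≥0∞) ν := by
  induction N with
  | zero => simpa using aestronglyMeasurable_id
  | succ N ih =>
    rw [memLp_id_even_iff (Nat.succ_ne_zero N)]
    have hd : Differentiable ℂ (iteratedDeriv (2 * N) H) :=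
      (hH.contDiff (n := (2 * N + 1 : ℕ))).differentiable_iteratedDeriv _
        (by norm_cast; simp)
    obtain ⟨C, hC⟩ := exists_norm_second_difference_le hd
    have := lintegral_mul_sq_le (ν := ν) (w := fun x => x ^ (2 * N)) (by fun_prop) (C := C) ?_
    · refine lt_of_eq_of_lt (lintegral_congr fun x => ?_) (this.trans_lt ENNReal.ofReal_lt_top)
      rw [Nat.succ_eq_add_one, mul_add, pow_add]
    · intro t ht ht1
      have hint0 : Integrable (fun x : ℝ => x ^ (2 * N)) ν := by
        have := ih.integrable_norm_pow'
        simpa [abs_pow, pow_mul, sq_abs] using this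
      have hint : Integrable (fun x : ℝ => x ^ (2 * N) * (2 * (1 - Real.cos (t * x)))) ν := by
        refine (hint0.norm.mul_const 4).mono' (by fun_prop) (Eventually.of_forall fun x => ?_)
        rw [norm_mul]
        gcongr
        rw [Real.norm_eq_abs, abs_le]
        constructor <;> linarith [Real.neg_one_le_cos (t * x), Real.cos_le_one (t * x)]
      rw [← ofReal_integral_eq_lintegral_ofReal hint (Eventually.of_forall fun x => ?_)]
      · refine ENNReal.ofReal_le_ofReal ?_
        have e := integral_pow_mul_one_sub_cos hH hchar ih t
        have e2 := congrArg norm e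
        rw [norm_mul, norm_pow, norm_neg, norm_one, one_pow, one_mul, Complex.norm_real] at e2
        exact (le_abs_self _).trans (e2.le.trans (hC t ht ht1))
      · refine mul_nonneg (by rw [pow_mul]; positivity) ?_
        linarith [Real.cos_le_one (t * x)]

/-- Cauchy's estimate for the even moments, when the characteristic function is the exponential of
an entire function bounded on the unit circle. -/
theorem lintegral_pow_le_of_charFun_eq_exp {L : ℂ → ℂ} (hL : Differentiable ℂ L)
    (hchar : ∀ t : ℝ, charFun ν t = Complex.exp (L t)) {C : ℝ}
    (hC : ∀ z : ℂ, ‖z‖ = 1 → ‖L z‖ ≤ C) {N : ℕ} (hN : N ≠ 0) :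
    ∫⁻ x, ENNReal.ofReal (x ^ (2 * N)) ∂ν
      ≤ ENNReal.ofReal ((2 * N).factorial * (Real.exp C - 1)) := by
  have hH : Differentiable ℂ (fun z => Complex.exp (L z)) := hL.cexp
  have hmem := memLp_of_charFun_entire hH hchar N
  have hint0 : Integrable (fun x : ℝ => x ^ (2 * N)) ν := by
    have := hmem.integrable_norm_pow'
    simpa [abs_pow, pow_mul, sq_abs] using this
  rw [← ofReal_integral_eq_lintegral_ofReal hint0
    (Eventually.of_forall fun x => by simp only [pow_mul]; positivity)]
  refine ENNReal.ofReal_le_ofReal ?_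
  have h1 := iteratedDeriv_charFun_zero hmem
  have hfun : charFun ν = fun t : ℝ => (fun z => Complex.exp (L z)) (t : ℂ) := funext hchar
  rw [hfun, iteratedDeriv_comp_ofReal hH, pow_mul, Complex.I_sq] at h1
  have h2 := congrArg norm h1
  rw [norm_mul, norm_pow, norm_neg, norm_one, one_pow, one_mul] at h2
  -- Subtracting `1` does not change derivatives of positive order, and makes the bound small with `C`.
  have hsub : iteratedDeriv (2 * N) (fun z => Complex.exp (L z) - 1) 0
      = iteratedDeriv (2 * N) (fun z => Complex.exp (L z)) 0 := by
    rw [iteratedDeriv_fun_sub (hH.contDiff.contDiffAt) contDiffAt_const, iteratedDeriv_const]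
    simp [hN]
  have h3 := Complex.norm_iteratedDeriv_le_of_forall_mem_sphere_norm_le (2 * N) (c := 0)
    (R := 1) (C := Real.exp C - 1) (f := fun z => Complex.exp (L z) - 1) one_pos
    ((hH.sub_const 1).diffContOnCl) (fun z hz => by
      have hz' : ‖z‖ = 1 := by simpa using hz
      refine (by simpa using Complex.norm_exp_sub_sum_le_exp_norm_sub_sum (L z) 1 :
        ‖Complex.exp (L z) - 1‖ ≤ Real.exp ‖L z‖ - 1).trans ?_
      gcongr
      exact hC z hz')
  rw [hsub] at h3
  simp only [Complex.ofReal_zero] at h2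
  rw [h2] at h3
  simp only [one_pow, div_one] at h3
  refine le_trans ?_ h3
  refine le_trans (le_abs_self _) ?_
  rw [← Real.norm_eq_abs, ← Complex.norm_real, ← integral_complex_ofReal]

/-- The second moment, when the real part of the characteristic function differs from `1` by at most
`C t² / 2`. -/
theorem lintegral_sq_le_of_charFun {C : ℝ}
    (h : ∀ t : ℝ, 2 * (1 - (charFun ν t).re) ≤ C * t ^ 2) :
    ∫⁻ x, ENNReal.ofReal (x ^ 2) ∂ν ≤ ENNReal.ofReal C := by
  have := lintegral_mul_sq_le (ν := ν) (w := fun _ => 1) (by fun_prop) (C := C) ?_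
  · simpa using this
  · intro t _ _
    have hre : (charFun ν t).re = ∫ x, Real.cos (t * x) ∂ν := by
      rw [charFun_apply_real]
      have hint : Integrable (fun x : ℝ => Complex.exp (t * x * Complex.I)) ν := by
        refine (integrable_const (1 : ℝ)).mono' (by fun_prop) (Eventually.of_forall fun x => ?_)
        rw [← Complex.ofReal_mul, Complex.norm_exp_ofReal_mul_I]
      rw [← RCLike.re_eq_complex_re, ← integral_re hint]
      refine integral_congr_ae (Eventually.of_forall fun x => ?_)
      simp only [RCLike.re_eq_complex_re]
      rw [← Complex.ofReal_mul, Complex.exp_ofReal_mul_I_re]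
    have hc : Integrable (fun x : ℝ => Real.cos (t * x)) ν :=
      (integrable_const (1 : ℝ)).mono' (by fun_prop)
        (Eventually.of_forall fun x => Real.abs_cos_le_one _)
    have hi : Integrable (fun x : ℝ => 2 * (1 - Real.cos (t * x))) ν :=
      ((integrable_const (1 : ℝ)).sub hc).const_mul 2
    simp only [one_mul]
    rw [← ofReal_integral_eq_lintegral_ofReal hi (Eventually.of_forall fun x => by
      simp only [Pi.zero_apply]; linarith [Real.cos_le_one (t * x)])]
    refine ENNReal.ofReal_le_ofReal ?_
    rw [integral_const_mul, integral_sub (integrable_const _) hc, ← hre]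
    simpa using h t

end

/-! ### The characteristic functional of the field along a test function -/

/-- The coefficient of `z^(2k+2)` in the cumulant series; `κ k` is the cumulant of order `2k + 2`. -/
def cumulantCoeff (κ : ℕ → ℝ) (k : ℕ) : ℝ := (-1) ^ (k + 1) * κ k / (2 * k + 2).factorial

/-- The series `∑ₖ (-1)^(k+1) κₖ z^(2k+2) / (2k+2)!`: the logarithm of the characteristic function of
a symmetric law with cumulants `κₖ` of order `2k + 2`. -/
def cumulantSeries (κ : ℕ → ℝ) (z : ℂ) : ℂ :=
  ∑' k, (cumulantCoeff κ k : ℂ) * z ^ (2 * k + 2)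

section

variable {κ : ℕ → ℝ} {A B : ℝ}

theorem abs_cumulantCoeff_mul_le (h0 : ∀ k, 0 ≤ κ k) (hκ : ∀ k, κ k ≤ A * B ^ (2 * k)) {R r : ℝ}
    (hr : 0 ≤ r) (hrR : r ≤ R) (k : ℕ) :
    |cumulantCoeff κ k| * r ^ (2 * k + 2)
      ≤ A * R ^ 2 * ((B * R) ^ (2 * k) / (2 * k).factorial) := by
  rw [cumulantCoeff, abs_div, abs_mul, abs_pow, abs_neg, abs_one, one_pow, one_mul,
    abs_of_nonneg (h0 k), Nat.abs_cast]
  have hAB : 0 ≤ A * B ^ (2 * k) := (h0 k).trans (hκ k)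
  calc κ k / (2 * k + 2).factorial * r ^ (2 * k + 2)
      ≤ (A * B ^ (2 * k)) / (2 * k).factorial * R ^ (2 * k + 2) := by
        have hf : ((2 * k).factorial : ℝ) ≤ (2 * k + 2).factorial :=
          Nat.cast_le.2 (Nat.factorial_le (by omega))
        have hf0 : (0 : ℝ) < (2 * k).factorial := by positivity
        gcongr
        exact hκ k
    _ = _ := by rw [mul_pow]; ring

theorem summable_cosh_terms (A R x : ℝ) :
    Summable fun k : ℕ => A * R ^ 2 * (x ^ (2 * k) / (2 * k).factorial) :=
  (Real.hasSum_cosh x).summable.mul_left _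

theorem differentiable_cumulantSeries (h0 : ∀ k, 0 ≤ κ k) (hκ : ∀ k, κ k ≤ A * B ^ (2 * k)) :
    Differentiable ℂ (cumulantSeries κ) := by
  intro z
  have hz : z ∈ Metric.ball (0 : ℂ) (‖z‖ + 1) := by simp
  refine (Complex.differentiableOn_tsum_of_summable_norm (U := Metric.ball (0 : ℂ) (‖z‖ + 1))
    (summable_cosh_terms A (‖z‖ + 1) (B * (‖z‖ + 1))) (fun k => by fun_prop) Metric.isOpen_ball
    fun k w hw => ?_).differentiableAt (Metric.isOpen_ball.mem_nhds hz)
  rw [norm_mul, norm_pow, Complex.norm_real, Real.norm_eq_abs]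
  exact abs_cumulantCoeff_mul_le h0 hκ (norm_nonneg _) (by simpa using (mem_ball_zero_iff.1 hw).le) k

theorem norm_cumulantSeries_le (h0 : ∀ k, 0 ≤ κ k) (hκ : ∀ k, κ k ≤ A * B ^ (2 * k)) {z : ℂ}
    (hz : ‖z‖ = 1) : ‖cumulantSeries κ z‖ ≤ A * Real.cosh B := by
  refine tsum_of_norm_bounded ((Real.hasSum_cosh B).mul_left A) fun k => ?_
  rw [norm_mul, norm_pow, Complex.norm_real, Real.norm_eq_abs]
  simpa using abs_cumulantCoeff_mul_le h0 hκ (norm_nonneg z) hz.le k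

end

/-- Bounds for the characteristic function of `⟨g, φ⟩`: its real part is at least
`1 - K² ‖g‖₂² t² / 2`, and it is the exponential of an entire function which, for any bound `b` of
`|g|`, is at most `K² ‖g‖₂² cosh (K b)` on the unit circle. -/
structure HasEntireExponent {n : ℕ} (μ : Measure (RealDistribution n)) (K : ℝ)
    (g : 𝓢(Spacetime n, ℝ)) : Prop where
  variance : ∀ t : ℝ, 2 * (1 - (charFun (μ.map fun φ => φ g) t).re) ≤ K ^ 2 * (∫ x, g x ^ 2) * t ^ 2
  entire : ∀ b : ℝ, (∀ x, |g x| ≤ b) → ∃ L : ℂ → ℂ, Differentiable ℂ L ∧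
    (∀ t : ℝ, charFun (μ.map fun φ => φ g) t = Complex.exp (L t)) ∧
    ∀ z : ℂ, ‖z‖ = 1 → ‖L z‖ ≤ K ^ 2 * (∫ x, g x ^ 2) * Real.cosh (K * b)

theorem continuous_eval {n : ℕ} (g : 𝓢(Spacetime n, ℝ)) :
    Continuous fun φ : RealDistribution n => φ g := by
  fun_prop

theorem measurable_eval {n : ℕ} (g : 𝓢(Spacetime n, ℝ)) :
    Measurable fun φ : RealDistribution n => φ g :=
  (continuous_eval g).measurable

theorem charFun_eval {n : ℕ} (μ : Measure (RealDistribution n)) (g : 𝓢(Spacetime n, ℝ)) (t : ℝ) :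
    charFun (μ.map fun φ => φ g) t
      = ∫ φ, Complex.exp (Complex.I * (((φ : RealDistribution n) (t • g) : ℝ) : ℂ)) ∂μ := by
  rw [charFun_apply_real, integral_map (measurable_eval g).aemeasurable (by fun_prop)]
  refine integral_congr_ae (Eventually.of_forall fun φ => ?_)
  simp only [map_smul, smul_eq_mul, Complex.ofReal_mul]
  ring_nf

theorem integrable_even_pow {n : ℕ} (g : 𝓢(Spacetime n, ℝ)) (k : ℕ) :
    Integrable fun x => g x ^ (2 * k + 2) := by
  have := (g.memLp ((2 * k + 2 : ℕ) : ℝ≥0∞) (volume : Measure (Spacetime n))).integrable_norm_pow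
    (by simp)
  refine this.congr (Eventually.of_forall fun x => ?_)
  simp only [Real.norm_eq_abs]
  rw [show 2 * k + 2 = 2 * (k + 1) by ring, pow_mul, sq_abs, ← pow_mul]

theorem hasEntireExponent_of_gaussian {n : ℕ} {μ : Measure (RealDistribution n)}
    (hμ : IsGaussianField μ) (g : 𝓢(Spacetime n, ℝ)) : HasEntireExponent μ 2 g := by
  -- The exponent is `-t² ‖g‖₂²`, so `K² / 2 = 2 ≥ 1` is enough for the constant `K = 2`.
  have hchar : ∀ t : ℝ, charFun (μ.map fun φ => φ g) t
      = Complex.exp (((-(t ^ 2 * ∫ x, g x ^ 2) : ℝ)) : ℂ) := by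
    intro t
    rw [charFun_eval, hμ, ← integral_const_mul]
    congr 4
    ext x
    simp [mul_pow]
  have h0 : 0 ≤ ∫ x, g x ^ 2 := integral_nonneg fun x => sq_nonneg _
  refine ⟨fun t => ?_, fun b _ => ⟨fun z => -(z ^ 2 * ((∫ x, g x ^ 2 : ℝ) : ℂ)), by fun_prop,
    fun t => by rw [hchar]; push_cast; rfl, fun z hz => ?_⟩⟩
  · rw [hchar, ← Complex.ofReal_exp, Complex.ofReal_re]
    have := Real.add_one_le_exp (-(t ^ 2 * ∫ x, g x ^ 2))
    nlinarith [mul_nonneg (sq_nonneg t) h0]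
  · rw [norm_neg, norm_mul, norm_pow, hz, one_pow, one_mul, Complex.norm_real,
      Real.norm_of_nonneg h0]
    have := Real.one_le_cosh (2 * b)
    nlinarith

/-! ### The exponent of the Lévy field -/

section Levy

variable {M : Measure ℝ}

theorem integrable_even_moment (h : ∃ K : ℝ, ∀ k : ℕ, 1 ≤ k →
    ∫⁻ s, ENNReal.ofReal (s ^ (2 * k)) ∂M < ENNReal.ofReal (K ^ (2 * k))) (k : ℕ) :
    Integrable (fun s : ℝ => s ^ (2 * k + 2)) M := by
  obtain ⟨K, hK⟩ := h
  have h1 : ∀ s : ℝ, 0 ≤ s ^ (2 * (k + 1)) := fun s => by rw [pow_mul]; positivity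
  rw [show 2 * k + 2 = 2 * (k + 1) by ring]
  exact (lintegral_ofReal_ne_top_iff_integrable (by fun_prop)
    (Eventually.of_forall h1)).1 ((hK (k + 1) (by omega)).trans ENNReal.ofReal_lt_top).ne

/-- The even moments of order `2k + 2` of a Lévy measure. -/
def levyMoment (M : Measure ℝ) (k : ℕ) : ℝ := ∫ s, s ^ (2 * k + 2) ∂M

theorem levyMoment_nonneg (M : Measure ℝ) (k : ℕ) : 0 ≤ levyMoment M k :=
  integral_nonneg fun s => by
    simp only [show 2 * k + 2 = 2 * (k + 1) by ring, pow_mul]; positivity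

theorem IsAdmissibleLevyMeasure.exists_levyMoment_le (hM : IsAdmissibleLevyMeasure M) :
    ∃ K : ℝ, 0 ≤ K ∧ ∀ k, levyMoment M k ≤ K ^ (2 * k + 2) := by
  obtain ⟨K, hK⟩ := hM.moments
  refine ⟨|K|, abs_nonneg K, fun k => ?_⟩
  have h := hK (k + 1) (by omega)
  have h1 : ∀ s : ℝ, 0 ≤ s ^ (2 * (k + 1)) := fun s => by rw [pow_mul]; positivity
  have hint := integrable_even_moment hM.moments k
  rw [show 2 * (k + 1) = 2 * k + 2 by ring] at h h1
  rw [← ofReal_integral_eq_lintegral_ofReal hint (Eventually.of_forall h1)] at h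
  have h2 := ENNReal.ofReal_lt_ofReal_iff_of_nonneg (levyMoment_nonneg M k) |>.1 h
  rw [show 2 * k + 2 = 2 * (k + 1) by ring, pow_mul, sq_abs, ← pow_mul]
  exact h2.le

theorem hasSum_cos_sub_one (r : ℝ) :
    HasSum (fun k : ℕ => (-1) ^ (k + 1) * r ^ (2 * k + 2) / (2 * k + 2).factorial)
      (Real.cos r - 1) := by
  have := (hasSum_nat_add_iff' 1).2 (Real.hasSum_cos r)
  simpa [mul_add] using this

/-- The expansion of the Lévy exponent in even cumulants. -/
theorem IsAdmissibleLevyMeasure.hasSum_levyExponent (hM : IsAdmissibleLevyMeasure M) (y : ℝ) :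
    HasSum (fun k => cumulantCoeff (fun k => levyMoment M k) k * y ^ (2 * k + 2))
      (levyExponent M y) := by
  obtain ⟨K, hK0, hK⟩ := hM.exists_levyMoment_le
  have hrestr : M.restrict ({0}ᶜ : Set ℝ) = M :=
    Measure.restrict_eq_self_of_ae_mem (compl_mem_ae_iff.2 hM.zero_singleton)
  have hF : ∀ k : ℕ, Integrable (fun s : ℝ =>
      (-1) ^ (k + 1) * (s * y) ^ (2 * k + 2) / (2 * k + 2).factorial) M := by
    intro k
    have := ((integrable_even_moment hM.moments k).mul_const (y ^ (2 * k + 2))).const_mul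
      ((-1) ^ (k + 1) / ((2 * k + 2).factorial : ℝ))
    refine this.congr (Eventually.of_forall fun s => ?_)
    simp only [mul_pow]; ring
  have hval : ∀ k : ℕ, ∫ s : ℝ, (-1) ^ (k + 1) * (s * y) ^ (2 * k + 2) / (2 * k + 2).factorial ∂M
      = cumulantCoeff (fun k => levyMoment M k) k * y ^ (2 * k + 2) := by
    intro k
    rw [cumulantCoeff, levyMoment, ← integral_const_mul, ← integral_div, ← integral_mul_const]
    refine integral_congr_ae (Eventually.of_forall fun s => ?_)
    simp only [mul_pow]; ring
  have hnorm : ∀ k : ℕ,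
      ∫ s : ℝ, ‖(-1) ^ (k + 1) * (s * y) ^ (2 * k + 2) / (2 * k + 2).factorial‖ ∂M
      = |cumulantCoeff (fun k => levyMoment M k) k| * |y| ^ (2 * k + 2) := by
    intro k
    have e : 2 * k + 2 = 2 * (k + 1) := by ring
    rw [cumulantCoeff, abs_div, abs_mul, abs_of_nonneg (levyMoment_nonneg M k), levyMoment,
      ← integral_const_mul, ← integral_div, ← integral_mul_const]
    refine integral_congr_ae (Eventually.of_forall fun s => ?_)
    simp only [norm_div, norm_mul, Real.norm_eq_abs, abs_pow, mul_pow]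
    rw [e, pow_mul |s|, sq_abs, ← pow_mul]
    ring
  have hsum := hasSum_integral_of_summable_integral_norm hF (by
    simp only [hnorm]
    refine Summable.of_nonneg_of_le (fun k => by positivity) (fun k =>
      abs_cumulantCoeff_mul_le (A := K ^ 2) (B := K) (levyMoment_nonneg M) (fun k => ?_)
        (abs_nonneg y) le_rfl k) (summable_cosh_terms (K ^ 2) (|y|) (K * |y|))
    rw [← pow_add, add_comm]
    exact hK k)
  simp only [hval] at hsum
  have hexp : levyExponent M y = ∫ s : ℝ, ∑' k : ℕ,
      (-1) ^ (k + 1) * (s * y) ^ (2 * k + 2) / (2 * k + 2).factorial ∂M := by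
    rw [levyExponent, hrestr]
    refine integral_congr_ae (Eventually.of_forall fun s => ?_)
    exact ((hasSum_cos_sub_one (s * y)).tsum_eq).symm
  rwa [← hexp] at hsum

theorem IsAdmissibleLevyMeasure.neg_levyExponent_le (hM : IsAdmissibleLevyMeasure M) (y : ℝ) :
    -levyExponent M y ≤ levyMoment M 0 / 2 * y ^ 2 := by
  have hrestr : M.restrict ({0}ᶜ : Set ℝ) = M :=
    Measure.restrict_eq_self_of_ae_mem (compl_mem_ae_iff.2 hM.zero_singleton)
  rw [levyExponent, hrestr, levyMoment, ← integral_neg, ← integral_div, ← integral_mul_const]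
  have hi := integrable_even_moment hM.moments 0
  refine integral_mono_of_nonneg (Eventually.of_forall fun s => ?_)
    ((hi.div_const 2).mul_const _) (Eventually.of_forall fun s => ?_)
  · simpa using Real.cos_le_one _
  · have := Real.one_sub_sq_div_two_le_cos (x := s * y)
    simp only [mul_zero, zero_add]
    linarith [mul_pow s y 2]

/-- The even cumulants of `⟨g, φ⟩` are the products of the moments of `M` with `∫ g^(2k+2)`. -/
theorem hasEntireExponent_of_levy {n : ℕ} {μ : Measure (RealDistribution n)}
    (hM : IsAdmissibleLevyMeasure M) (hμ : IsLevyField M μ) :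
    ∃ K : ℝ, 0 ≤ K ∧ ∀ g : 𝓢(Spacetime n, ℝ), HasEntireExponent μ K g := by
  obtain ⟨K, hK0, hK⟩ := hM.exists_levyMoment_le
  refine ⟨K, hK0, fun g => ?_⟩
  have hchar : ∀ t : ℝ, charFun (μ.map fun φ => φ g) t
      = Complex.exp (((∫ x, levyExponent M (t * g x) : ℝ)) : ℂ) := by
    intro t
    rw [charFun_eval, hμ]
    simp
  have h0 : 0 ≤ ∫ x, g x ^ 2 := integral_nonneg fun x => sq_nonneg _
  have hg2 : Integrable fun x => g x ^ 2 := integrable_even_pow g 0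
  refine ⟨fun t => ?_, fun b hb => ?_⟩
  · rw [hchar, ← Complex.ofReal_exp, Complex.ofReal_re]
    have h1 := Real.add_one_le_exp (∫ x, levyExponent M (t * g x))
    have h2 : -∫ x, levyExponent M (t * g x) ≤ ∫ x, levyMoment M 0 / 2 * (t * g x) ^ 2 := by
      rw [← integral_neg]
      refine integral_mono_of_nonneg (Eventually.of_forall fun x => ?_) ?_
        (Eventually.of_forall fun x => hM.neg_levyExponent_le _)
      · simp only [Pi.zero_apply, levyExponent]
        rw [← integral_neg]
        exact integral_nonneg fun s => by simpa using Real.cos_le_one _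
      · simp only [mul_pow]
        exact (hg2.const_mul _).const_mul _
    simp only [mul_pow] at h2
    rw [integral_const_mul, integral_const_mul] at h2
    have h3 : levyMoment M 0 * (t ^ 2 * ∫ x, g x ^ 2) ≤ K ^ 2 * (t ^ 2 * ∫ x, g x ^ 2) := by
      have := hK 0
      simp only [mul_zero, zero_add] at this
      gcongr
    linarith
  · have hb0 : 0 ≤ b := (abs_nonneg _).trans (hb 0)
    set κ : ℕ → ℝ := fun k => levyMoment M k * ∫ x, g x ^ (2 * k + 2) with hκdef
    have hpos : ∀ (k : ℕ) (r : ℝ), 0 ≤ r ^ (2 * k + 2) := fun k r => by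
      rw [show 2 * k + 2 = 2 * (k + 1) by ring, pow_mul]; positivity
    have hκ0 : ∀ k, 0 ≤ κ k := fun k =>
      mul_nonneg (levyMoment_nonneg M k) (integral_nonneg fun x => hpos k _)
    have hκ : ∀ k, κ k ≤ K ^ 2 * (∫ x, g x ^ 2) * (K * b) ^ (2 * k) := by
      intro k
      have h1 : ∫ x, g x ^ (2 * k + 2) ≤ b ^ (2 * k) * ∫ x, g x ^ 2 := by
        rw [← integral_const_mul]
        refine integral_mono (integrable_even_pow g k) (hg2.const_mul _) fun x => ?_
        simp only
        rw [pow_add, pow_mul, ← sq_abs (g x), ← pow_mul]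
        gcongr
        exact hb x
      calc κ k ≤ K ^ (2 * k + 2) * (b ^ (2 * k) * ∫ x, g x ^ 2) := by
            refine mul_le_mul (hK k) h1 (integral_nonneg fun x => hpos k _) (hpos k _)
        _ = _ := by rw [mul_pow, pow_add]; ring
    refine ⟨cumulantSeries κ, differentiable_cumulantSeries hκ0 hκ, fun t => ?_, fun z hz =>
      norm_cumulantSeries_le hκ0 hκ hz⟩
    rw [hchar]
    congr 1
    set F : ℕ → Spacetime n → ℝ := fun k x =>
      cumulantCoeff (fun k => levyMoment M k) k * (t * g x) ^ (2 * k + 2) with hFdef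
    have hF : ∀ k, Integrable (F k) := fun k => by
      simp only [hFdef, mul_pow]
      exact ((integrable_even_pow g k).const_mul _).const_mul _
    have hval : ∀ k, ∫ x, F k x = cumulantCoeff κ k * t ^ (2 * k + 2) := by
      intro k
      simp only [hFdef, mul_pow]
      rw [integral_const_mul, integral_const_mul, cumulantCoeff, cumulantCoeff]
      simp only [hκdef]
      ring
    have hnorm : ∀ k, ∫ x, ‖F k x‖ = |cumulantCoeff κ k| * |t| ^ (2 * k + 2) := by
      intro k
      rw [← abs_pow, ← abs_mul, ← hval]
      have e : ∀ x, ‖F k x‖ = |cumulantCoeff (fun k => levyMoment M k) k|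
          * (t * g x) ^ (2 * k + 2) := fun x => by
        simp only [hFdef]
        rw [norm_mul, Real.norm_eq_abs, Real.norm_of_nonneg (hpos k (t * g x))]
      simp only [e]
      simp only [hFdef]
      rw [integral_const_mul, integral_const_mul, abs_mul,
        abs_of_nonneg (integral_nonneg fun x => hpos k _)]
    have hsum := hasSum_integral_of_summable_integral_norm hF (by
      simp only [hnorm]
      exact Summable.of_nonneg_of_le (fun k => by positivity) (fun k =>
        abs_cumulantCoeff_mul_le hκ0 hκ (abs_nonneg t) le_rfl k) (summable_cosh_terms _ _ _))
    have e1 : ∫ x, levyExponent M (t * g x) = ∫ x, ∑' k, F k x :=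
      integral_congr_ae (Eventually.of_forall fun x => ((hM.hasSum_levyExponent _).tsum_eq).symm)
    rw [e1, ← hsum.tsum_eq, cumulantSeries, Complex.ofReal_tsum]
    refine tsum_congr fun k => ?_
    rw [hval]
    push_cast
    rfl

end Levy

theorem exists_hasEntireExponent {n : ℕ} {μ : Measure (RealDistribution n)}
    (hμ : IsGaussianField μ ∨ ∃ M : Measure ℝ, IsAdmissibleLevyMeasure M ∧ IsLevyField M μ) :
    ∃ K : ℝ, 0 ≤ K ∧ ∀ g : 𝓢(Spacetime n, ℝ), HasEntireExponent μ K g := by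
  rcases hμ with h | ⟨M, hM, h⟩
  · exact ⟨2, by norm_num, hasEntireExponent_of_gaussian h⟩
  · exact hasEntireExponent_of_levy hM h

/-! ### Moments of the pairing with a test function -/

theorem eLpNorm_even_eq {α : Type*} [MeasurableSpace α] {ν : Measure α} (f : α → ℝ) {N : ℕ}
    (hN : N ≠ 0) : eLpNorm f ((2 * N : ℕ) : ℝ≥0∞) ν
      = (∫⁻ x, ENNReal.ofReal (f x ^ (2 * N)) ∂ν) ^ (1 / ((2 * N : ℕ) : ℝ)) := by
  rw [eLpNorm_eq_lintegral_rpow_enorm_toReal (by simpa using hN) (ENNReal.natCast_ne_top _)]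
  simp only [ENNReal.toReal_natCast, ENNReal.rpow_natCast]
  congr 1
  refine lintegral_congr fun x => ?_
  rw [← ofReal_norm, ← ENNReal.ofReal_pow (norm_nonneg _), Real.norm_eq_abs,
    pow_mul, sq_abs, ← pow_mul]

theorem eLpNorm_two_eq_ofReal_integral {n : ℕ} (g : 𝓢(Spacetime n, ℝ)) :
    eLpNorm g 2 volume = ENNReal.ofReal (∫ x, g x ^ 2) ^ (1 / 2 : ℝ) := by
  have := eLpNorm_even_eq (ν := (volume : Measure (Spacetime n))) g one_ne_zero
  rw [mul_one, Nat.cast_ofNat, Nat.cast_ofNat] at this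
  rw [this, ← ofReal_integral_eq_lintegral_ofReal (by simpa using integrable_even_pow g 0)
    (Eventually.of_forall fun x => sq_nonneg _)]

section

variable {n : ℕ} {μ : Measure (RealDistribution n)}

theorem pairing_add (v w : Test n) (φ : RealDistribution n) :
    pairing (v + w) φ = pairing v φ + pairing w φ := by
  simp only [pairing, map_add, Complex.ofReal_add]; ring

theorem pairing_sub (v w : Test n) (φ : RealDistribution n) :
    pairing (v - w) φ = pairing v φ - pairing w φ := by
  simp only [pairing, map_sub, Complex.ofReal_sub]; ring

theorem pairing_smul (c : ℂ) (v : Test n) (φ : RealDistribution n) :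
    pairing (c • v) φ = c * pairing v φ := by
  have h1 : (c • v).postcompCLM Complex.reCLM
      = c.re • v.postcompCLM Complex.reCLM - c.im • v.postcompCLM Complex.imCLM := by
    ext x; simp [SchwartzMap.postcompCLM_apply]
  have h2 : (c • v).postcompCLM Complex.imCLM
      = c.re • v.postcompCLM Complex.imCLM + c.im • v.postcompCLM Complex.reCLM := by
    ext x; simp [SchwartzMap.postcompCLM_apply]
  simp only [pairing, h1, h2, map_sub, map_add, map_smul, smul_eq_mul, Complex.ofReal_sub,
    Complex.ofReal_add, Complex.ofReal_mul]
  conv_rhs => rw [← Complex.re_add_im c]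
  linear_combination (-(c.im : ℂ) * (φ (v.postcompCLM Complex.imCLM) : ℂ)) * Complex.I_sq

theorem conjTest_apply (v : Test n) (x : Spacetime n) : conjTest v x = conj (v x) := by
  simp [conjTest, SchwartzMap.postcompCLM_apply]

theorem pairing_conjTest (v : Test n) (φ : RealDistribution n) :
    pairing (conjTest v) φ = conj (pairing v φ) := by
  have h1 : (conjTest v).postcompCLM Complex.reCLM = v.postcompCLM Complex.reCLM := by
    ext x; simp [SchwartzMap.postcompCLM_apply, conjTest_apply]
  have h2 : (conjTest v).postcompCLM Complex.imCLM = -v.postcompCLM Complex.imCLM := by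
    ext x; simp [SchwartzMap.postcompCLM_apply, conjTest_apply]
  simp [pairing, h1, h2]

theorem measurable_pairing (v : Test n) : Measurable fun φ => pairing v φ :=
  (Complex.measurable_ofReal.comp (measurable_eval _)).add
    ((Complex.measurable_ofReal.comp (measurable_eval _)).const_mul _)

theorem aestronglyMeasurable_pairing (v : Test n) :
    AEStronglyMeasurable (fun φ => pairing v φ) μ :=
  (measurable_pairing v).aestronglyMeasurable

theorem eLpNorm_pairing_le (v : Test n) {p : ℝ≥0∞} (hp : 1 ≤ p) :
    eLpNorm (fun φ => pairing v φ) p μ ≤ eLpNorm (fun φ => φ (v.postcompCLM Complex.reCLM)) p μ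
      + eLpNorm (fun φ => φ (v.postcompCLM Complex.imCLM)) p μ := by
  refine (eLpNorm_mono (g := fun φ : RealDistribution n =>
    ‖φ (v.postcompCLM Complex.reCLM)‖ + ‖φ (v.postcompCLM Complex.imCLM)‖) fun φ => ?_).trans
    ((eLpNorm_add_le (measurable_eval _).norm.aestronglyMeasurable
      (measurable_eval _).norm.aestronglyMeasurable hp).trans (le_of_eq ?_))
  · rw [Real.norm_of_nonneg (by positivity), pairing]
    refine (norm_add_le _ _).trans (le_of_eq ?_)
    simp
  · rw [eLpNorm_norm, eLpNorm_norm]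

variable [IsProbabilityMeasure μ] {K : ℝ}

instance (g : 𝓢(Spacetime n, ℝ)) : IsProbabilityMeasure (μ.map fun φ => φ g) :=
  Measure.isProbabilityMeasure_map (measurable_eval g).aemeasurable

theorem eLpNorm_eval_two_le (hK : 0 ≤ K) {g : 𝓢(Spacetime n, ℝ)} (hg : HasEntireExponent μ K g) :
    eLpNorm (fun φ => φ g) 2 μ ≤ ENNReal.ofReal K * eLpNorm g 2 volume := by
  have h := lintegral_sq_le_of_charFun hg.variance
  rw [lintegral_map (by fun_prop) (measurable_eval g)] at h
  have e := eLpNorm_even_eq (ν := μ) (fun φ => φ g) one_ne_zero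
  rw [mul_one, Nat.cast_ofNat, Nat.cast_ofNat] at e
  rw [e, eLpNorm_two_eq_ofReal_integral]
  refine (ENNReal.rpow_le_rpow h (by norm_num)).trans ?_
  rw [ENNReal.ofReal_mul (sq_nonneg K), ENNReal.mul_rpow_of_nonneg _ _ (by norm_num),
    ENNReal.ofReal_pow hK, ← ENNReal.rpow_natCast, ← ENNReal.rpow_mul]
  norm_num

theorem eLpNorm_eval_even_le {g : 𝓢(Spacetime n, ℝ)} (hg : HasEntireExponent μ K g) {b : ℝ}
    (hb : ∀ x, |g x| ≤ b) {N : ℕ} (hN : N ≠ 0) :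
    eLpNorm (fun φ => φ g) ((2 * N : ℕ) : ℝ≥0∞) μ ≤
      ENNReal.ofReal ((2 * N).factorial *
        (Real.exp (K ^ 2 * (∫ x, g x ^ 2) * Real.cosh (K * b)) - 1)) ^ (1 / ((2 * N : ℕ) : ℝ)) := by
  obtain ⟨L, hL, hchar, hC⟩ := hg.entire b hb
  have h := lintegral_pow_le_of_charFun_eq_exp hL hchar hC hN
  rw [lintegral_map (by fun_prop) (measurable_eval g)] at h
  rw [eLpNorm_even_eq _ hN]
  exact ENNReal.rpow_le_rpow h (by positivity)

theorem exists_le_even {p : ℝ≥0∞} (hp : p ≠ ∞) : ∃ N : ℕ, N ≠ 0 ∧ p ≤ ((2 * N : ℕ) : ℝ≥0∞) := by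
  obtain ⟨N, hN⟩ := ENNReal.exists_nat_gt hp
  refine ⟨N + 1, Nat.succ_ne_zero N, hN.le.trans ?_⟩
  exact_mod_cast (by omega : N ≤ 2 * (N + 1))

theorem memLp_eval {g : 𝓢(Spacetime n, ℝ)} (hg : HasEntireExponent μ K g) {p : ℝ≥0∞}
    (hp : p ≠ ∞) : MemLp (fun φ => φ g) p μ := by
  obtain ⟨N, hN, hpN⟩ := exists_le_even hp
  obtain ⟨b, hb⟩ : ∃ b, ∀ x, |g x| ≤ b := ⟨_, fun x => g.norm_le_seminorm ℝ x⟩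
  refine MemLp.mono_exponent ⟨(measurable_eval g).aestronglyMeasurable, ?_⟩ hpN
  refine (eLpNorm_eval_even_le hg hb hN).trans_lt ?_
  exact ENNReal.rpow_lt_top_of_nonneg (by positivity) ENNReal.ofReal_ne_top

theorem tendsto_eLpNorm_eval {ι : Type*} {l : Filter ι} {g : ι → 𝓢(Spacetime n, ℝ)}
    (hg : ∀ i, HasEntireExponent μ K (g i)) {b : ℝ} (hb : ∀ i x, |g i x| ≤ b)
    (h2 : Tendsto (fun i => eLpNorm (g i) 2 volume) l (𝓝 0)) {p : ℝ≥0∞} (hp : p ≠ ∞) :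
    Tendsto (fun i => eLpNorm (fun φ => φ (g i)) p μ) l (𝓝 0) := by
  obtain ⟨N, hN, hpN⟩ := exists_le_even hp
  have hI : Tendsto (fun i => ∫ x, g i x ^ 2) l (𝓝 0) := by
    have h3 : Tendsto (fun i => (eLpNorm (g i) 2 volume ^ (2 : ℝ)).toReal) l (𝓝 0) := by
      have := ((ENNReal.tendsto_toReal (by simp)).comp
        ((ENNReal.continuous_rpow_const (y := (2 : ℝ))).tendsto 0)).comp h2
      simpa [Function.comp_def] using this
    refine h3.congr fun i => ?_
    rw [eLpNorm_two_eq_ofReal_integral, ← ENNReal.rpow_mul]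
    norm_num
    exact integral_nonneg fun x => sq_nonneg _
  have hb' : Tendsto (fun i => ENNReal.ofReal ((2 * N).factorial *
      (Real.exp (K ^ 2 * (∫ x, g i x ^ 2) * Real.cosh (K * b)) - 1)) ^ (1 / ((2 * N : ℕ) : ℝ)))
      l (𝓝 0) := by
    have hc : Continuous fun I : ℝ => ENNReal.ofReal ((2 * N).factorial *
      (Real.exp (K ^ 2 * I * Real.cosh (K * b)) - 1)) ^ (1 / ((2 * N : ℕ) : ℝ)) :=
      ENNReal.continuous_rpow_const.comp (ENNReal.continuous_ofReal.comp (by fun_prop))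
    have h4 := (hc.tendsto 0).comp hI
    have e : (1 / ((2 * N : ℕ) : ℝ)) ≠ 0 := by positivity
    simp only [mul_zero, zero_mul, Real.exp_zero, sub_self, ENNReal.ofReal_zero] at h4
    rwa [ENNReal.zero_rpow_of_pos (by positivity)] at h4
  refine tendsto_of_tendsto_of_tendsto_of_le_of_le tendsto_const_nhds hb'
    (fun _ => zero_le) fun i => ?_
  exact (eLpNorm_le_eLpNorm_of_exponent_le hpN
    (measurable_eval (g i)).aestronglyMeasurable).trans (eLpNorm_eval_even_le (hg i) (hb i) hN)

theorem eLpNorm_re_le (v : Test n) (p : ℝ≥0∞) :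
    eLpNorm (v.postcompCLM Complex.reCLM) p volume ≤ eLpNorm v p volume :=
  eLpNorm_mono fun x => by
    simpa [SchwartzMap.postcompCLM_apply] using Complex.abs_re_le_norm (v x)

theorem eLpNorm_im_le (v : Test n) (p : ℝ≥0∞) :
    eLpNorm (v.postcompCLM Complex.imCLM) p volume ≤ eLpNorm v p volume :=
  eLpNorm_mono fun x => by
    simpa [SchwartzMap.postcompCLM_apply] using Complex.abs_im_le_norm (v x)

theorem eLpNorm_pairing_two_le (hK : 0 ≤ K) (hE : ∀ g, HasEntireExponent μ K g) (v : Test n) :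
    eLpNorm (fun φ => pairing v φ) 2 μ ≤ 2 * ENNReal.ofReal K * eLpNorm v 2 volume := by
  refine (eLpNorm_pairing_le v (by norm_num)).trans ?_
  rw [mul_assoc, two_mul]
  refine add_le_add ((eLpNorm_eval_two_le hK (hE _)).trans ?_)
    ((eLpNorm_eval_two_le hK (hE _)).trans ?_)
  · gcongr; exact eLpNorm_re_le v 2
  · gcongr; exact eLpNorm_im_le v 2

theorem memLp_pairing (hE : ∀ g, HasEntireExponent μ K g) (v : Test n) {p : ℝ≥0∞} (hp : 1 ≤ p)
    (hp' : p ≠ ∞) : MemLp (fun φ => pairing v φ) p μ :=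
  ⟨aestronglyMeasurable_pairing v, (eLpNorm_pairing_le v hp).trans_lt
    (ENNReal.add_lt_top.2 ⟨(memLp_eval (hE _) hp').2, (memLp_eval (hE _) hp').2⟩)⟩

/-- Test functions that stay uniformly bounded and tend to zero in `L²(ℝ^d)` are paired with the
field to variables tending to zero in every `L^p(μ)`. -/
theorem tendsto_eLpNorm_pairing (hE : ∀ g, HasEntireExponent μ K g) {ι : Type*} {l : Filter ι}
    {u : ι → Test n} {b : ℝ} (hb : ∀ i x, ‖u i x‖ ≤ b)
    (h2 : Tendsto (fun i => eLpNorm (u i) 2 volume) l (𝓝 0)) {p : ℝ≥0∞} (hp : 1 ≤ p)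
    (hp' : p ≠ ∞) : Tendsto (fun i => eLpNorm (fun φ => pairing (u i) φ) p μ) l (𝓝 0) := by
  have hre := tendsto_eLpNorm_eval (μ := μ) (l := l)
    (g := fun i => (u i).postcompCLM Complex.reCLM) (fun i => hE _) (b := b)
    (fun i x => (by simpa [SchwartzMap.postcompCLM_apply] using
      (Complex.abs_re_le_norm (u i x)).trans (hb i x)))
    (tendsto_of_tendsto_of_tendsto_of_le_of_le tendsto_const_nhds h2 (fun _ => zero_le)
      fun i => eLpNorm_re_le _ _) hp'
  have him := tendsto_eLpNorm_eval (μ := μ) (l := l)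
    (g := fun i => (u i).postcompCLM Complex.imCLM) (fun i => hE _) (b := b)
    (fun i x => (by simpa [SchwartzMap.postcompCLM_apply] using
      (Complex.abs_im_le_norm (u i x)).trans (hb i x)))
    (tendsto_of_tendsto_of_tendsto_of_le_of_le tendsto_const_nhds h2 (fun _ => zero_le)
      fun i => eLpNorm_im_le _ _) hp'
  have := hre.add him
  rw [add_zero] at this
  exact tendsto_of_tendsto_of_tendsto_of_le_of_le tendsto_const_nhds this
    (fun _ => zero_le) fun i => eLpNorm_pairing_le _ hp

end

/-! ### Existence and uniqueness of stochastic extensions -/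

/-- If `|u| ≤ 1` and `p ≥ 2`, then `|u|^p ≤ |u|²`, so convergence to zero in `L²` implies it in
`L^p`. -/
theorem tendsto_eLpNorm_of_norm_le_one {α ι E : Type*} [MeasurableSpace α] [NormedAddCommGroup E]
    {ν : Measure α} {l : Filter ι} {u : ι → α → E} (hu : ∀ i x, ‖u i x‖ ≤ 1)
    (h2 : Tendsto (fun i => eLpNorm (u i) 2 ν) l (𝓝 0)) {p : ℝ≥0∞} (hp : 2 ≤ p) (hp' : p ≠ ∞) :
    Tendsto (fun i => eLpNorm (u i) p ν) l (𝓝 0) := by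
  have hp2 : 2 ≤ p.toReal := by simpa using ENNReal.toReal_mono hp' hp
  have hp0 : p ≠ 0 := (lt_of_lt_of_le (by norm_num) hp).ne'
  have key : ∀ i, eLpNorm (u i) p ν ≤ (eLpNorm (u i) 2 ν ^ (2 : ℝ)) ^ (1 / p.toReal) := by
    intro i
    rw [eLpNorm_eq_lintegral_rpow_enorm_toReal hp0 hp',
      eLpNorm_eq_lintegral_rpow_enorm_toReal two_ne_zero ENNReal.ofNat_ne_top]
    simp only [ENNReal.toReal_ofNat]
    rw [← ENNReal.rpow_mul _ (1 / 2) (2 : ℝ), one_div_mul_cancel two_ne_zero, ENNReal.rpow_one]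
    refine ENNReal.rpow_le_rpow (lintegral_mono fun x => ?_) (by positivity)
    refine ENNReal.rpow_le_rpow_of_exponent_ge ?_ hp2
    rw [← ofReal_norm]
    exact ENNReal.ofReal_le_one.2 (hu i x)
  refine tendsto_of_tendsto_of_tendsto_of_le_of_le tendsto_const_nhds ?_ (fun _ => zero_le) key
  have h3 := (((ENNReal.continuous_rpow_const (y := 1 / p.toReal)).comp
    (ENNReal.continuous_rpow_const (y := (2 : ℝ)))).tendsto 0).comp h2
  have hpos : 0 < 1 / p.toReal := by positivity
  rwa [Function.comp_apply, ENNReal.zero_rpow_of_pos two_pos, ENNReal.zero_rpow_of_pos hpos] at h3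

section

variable {n : ℕ} {μ : Measure (RealDistribution n)} {K : ℝ} {F G : Spacetime n → ℂ}
  {X Y : RealDistribution n →ₘ[μ] ℂ}

theorem IsStochasticExtension.add (hF : AEStronglyMeasurable F volume)
    (hG : AEStronglyMeasurable G volume) (hX : IsStochasticExtension μ F X)
    (hY : IsStochasticExtension μ G Y) : IsStochasticExtension μ (F + G) (X + Y) := by
  obtain ⟨v, hv⟩ := hX
  obtain ⟨w, hw⟩ := hY
  refine ⟨fun k => v k + w k, fun p hp hp' => ?_⟩
  have hp1 : 1 ≤ p := le_trans (by norm_num) hp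
  have h1 := (hv p hp hp').1.add (hw p hp hp').1
  have h2 := (hv p hp hp').2.add (hw p hp hp').2
  rw [add_zero] at h1 h2
  constructor
  · refine tendsto_of_tendsto_of_tendsto_of_le_of_le tendsto_const_nhds h1
      (fun _ => zero_le) fun k => ?_
    refine le_trans (le_of_eq ?_) (eLpNorm_add_le
      ((v k).continuous.aestronglyMeasurable.sub hF)
      ((w k).continuous.aestronglyMeasurable.sub hG) hp1)
    congr 1
    ext x
    simp only [_root_.add_apply, Pi.add_apply]
    ring
  · refine tendsto_of_tendsto_of_tendsto_of_le_of_le tendsto_const_nhds h2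
      (fun _ => zero_le) fun k => ?_
    refine le_trans (le_of_eq ?_) (eLpNorm_add_le
      ((aestronglyMeasurable_pairing (v k)).sub X.aestronglyMeasurable)
      ((aestronglyMeasurable_pairing (w k)).sub Y.aestronglyMeasurable) hp1)
    refine eLpNorm_congr_ae ?_
    filter_upwards [AEEqFun.coeFn_add X Y] with φ h
    simp only [h, Pi.add_apply, pairing_add]
    ring

theorem IsStochasticExtension.smul (c : ℂ) (hX : IsStochasticExtension μ F X) :
    IsStochasticExtension μ (c • F) (c • X) := by
  obtain ⟨v, hv⟩ := hX
  refine ⟨fun k => c • v k, fun p hp hp' => ?_⟩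
  have h1 := ENNReal.Tendsto.const_mul (a := ‖c‖ₑ) (hv p hp hp').1 (Or.inr enorm_ne_top)
  have h2 := ENNReal.Tendsto.const_mul (a := ‖c‖ₑ) (hv p hp hp').2 (Or.inr enorm_ne_top)
  rw [mul_zero] at h1 h2
  constructor
  · refine h1.congr fun k => ?_
    rw [← eLpNorm_const_smul]
    congr 1
    ext x
    simp only [_root_.smul_apply, Pi.smul_apply, smul_eq_mul]
    ring
  · refine h2.congr fun k => ?_
    rw [← eLpNorm_const_smul]
    refine eLpNorm_congr_ae ?_
    filter_upwards [AEEqFun.coeFn_smul c X] with φ h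
    simp only [h, Pi.smul_apply, pairing_smul, smul_eq_mul]
    ring

/-- Since the field is real, conjugation of the test function conjugates the random variable. -/
theorem IsStochasticExtension.star (hX : IsStochasticExtension μ F X) :
    IsStochasticExtension μ (star F) (star X) := by
  obtain ⟨v, hv⟩ := hX
  refine ⟨fun k => conjTest (v k), fun p hp hp' => ⟨?_, ?_⟩⟩
  · refine (hv p hp hp').1.congr fun k => eLpNorm_congr_norm_ae (Eventually.of_forall fun x => ?_)
    rw [conjTest_apply, Pi.star_apply, ← starRingEnd_apply, ← map_sub, RCLike.norm_conj]
  · refine (hv p hp hp').2.congr fun k => eLpNorm_congr_norm_ae ?_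
    filter_upwards [AEEqFun.coeFn_star X] with φ h
    rw [h, pairing_conjTest, Pi.star_apply, ← starRingEnd_apply, ← map_sub, RCLike.norm_conj]

variable [IsProbabilityMeasure μ]

/-- The second moment of a stochastic extension is controlled by the `L²`-norm. -/
theorem IsStochasticExtension.eLpNorm_two_le (hK : 0 ≤ K) (hE : ∀ g, HasEntireExponent μ K g)
    (hF : AEStronglyMeasurable F volume) (hX : IsStochasticExtension μ F X) :
    eLpNorm X 2 μ ≤ 2 * ENNReal.ofReal K * eLpNorm F 2 volume := by
  obtain ⟨v, hv⟩ := hX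
  obtain ⟨h1, h2⟩ := hv 2 le_rfl ENNReal.ofNat_ne_top
  have hC : 2 * ENNReal.ofReal K ≠ ∞ := ENNReal.mul_ne_top ENNReal.ofNat_ne_top ENNReal.ofReal_ne_top
  have h3 : Tendsto (fun k => eLpNorm (fun φ => pairing (v k) φ - X φ) 2 μ
      + 2 * ENNReal.ofReal K * (eLpNorm (fun x => v k x - F x) 2 volume + eLpNorm F 2 volume))
      atTop (𝓝 (0 + 2 * ENNReal.ofReal K * (0 + eLpNorm F 2 volume))) :=
    h2.add (ENNReal.Tendsto.const_mul (h1.add tendsto_const_nhds) (Or.inr hC))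
  rw [zero_add, zero_add] at h3
  refine ge_of_tendsto h3 (Eventually.of_forall fun k => ?_)
  have e1 : (X : RealDistribution n → ℂ)
      = (fun φ => pairing (v k) φ) - (fun φ => pairing (v k) φ - X φ) := by
    ext φ; simp
  have e2 : (v k : Spacetime n → ℂ) = (fun x => v k x - F x) + F := by ext x; simp
  calc eLpNorm X 2 μ
      ≤ eLpNorm (fun φ => pairing (v k) φ) 2 μ + eLpNorm (fun φ => pairing (v k) φ - X φ) 2 μ := by
        conv_lhs => rw [e1]
        exact eLpNorm_sub_le (aestronglyMeasurable_pairing _)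
          ((aestronglyMeasurable_pairing _).sub X.aestronglyMeasurable) (by norm_num)
    _ ≤ _ := by
        rw [add_comm]
        refine add_le_add_right ((eLpNorm_pairing_two_le hK hE _).trans ?_) _
        refine mul_le_mul_right ?_ _
        conv_lhs => rw [e2]
        exact eLpNorm_add_le ((v k).continuous.aestronglyMeasurable.sub hF) hF (by norm_num)

theorem IsStochasticExtension.unique (hK : 0 ≤ K) (hE : ∀ g, HasEntireExponent μ K g)
    (hF : AEStronglyMeasurable F volume) (hX : IsStochasticExtension μ F X)
    (hY : IsStochasticExtension μ F Y) : X = Y := by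
  have hZ := hX.add hF (hF.const_smul (-1 : ℂ)) (hY.smul (-1))
  have h := hZ.eLpNorm_two_le hK hE (hF.add (hF.const_smul (-1 : ℂ)))
  have e : F + (-1 : ℂ) • F = 0 := by simp
  rw [e, eLpNorm_zero, mul_zero, nonpos_iff_eq_zero,
    eLpNorm_eq_zero_iff (AEEqFun.aestronglyMeasurable _) two_ne_zero] at h
  apply AEEqFun.ext
  filter_upwards [h, AEEqFun.coeFn_add X ((-1 : ℂ) • Y), AEEqFun.coeFn_smul (-1 : ℂ) Y]
    with φ h1 h2 h3
  rw [h2, Pi.add_apply, h3] at h1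
  simp only [Pi.smul_apply, smul_eq_mul, Pi.zero_apply] at h1
  linear_combination h1

theorem IsStochasticExtension.memLp (hE : ∀ g, HasEntireExponent μ K g)
    (hX : IsStochasticExtension μ F X) {p : ℝ≥0∞} (hp' : p ≠ ∞) :
    MemLp X p μ := by
  wlog hp : 2 ≤ p generalizing p
  · exact (this ENNReal.ofNat_ne_top (le_refl 2)).mono_exponent (not_le.1 hp).le
  obtain ⟨v, hv⟩ := hX
  have h2 := (hv p hp hp').2
  obtain ⟨k, hk⟩ := (h2.eventually (gt_mem_nhds ENNReal.zero_lt_top)).exists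
  have hm : MemLp (fun φ => pairing (v k) φ - X φ) p μ :=
    ⟨(aestronglyMeasurable_pairing _).sub X.aestronglyMeasurable, hk⟩
  have := (memLp_pairing hE (v k) (le_trans (by norm_num) hp) hp').sub hm
  refine this.ae_eq (Eventually.of_forall fun φ => ?_)
  simp

/-- A function that is approximated by test functions in `L²`, with errors that stay bounded, has a
stochastic extension. -/
theorem exists_isStochasticExtension (hE : ∀ g, HasEntireExponent μ K g)
    (hF : AEStronglyMeasurable F volume) {v : ℕ → Test n} (hv : ∀ k x, ‖v k x - F x‖ ≤ 1)
    (h2 : Tendsto (fun k => eLpNorm (fun x => v k x - F x) 2 volume) atTop (𝓝 0)) :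
    ∃ X, IsStochasticExtension μ F X := by
  have hmem : ∀ k, MemLp (fun φ => pairing (v k) φ) 2 μ := fun k =>
    memLp_pairing hE (v k) (by norm_num) ENNReal.ofNat_ne_top
  have hd : Tendsto (fun q : ℕ × ℕ => eLpNorm (v q.1 - v q.2 : Test n) 2 volume) atTop (𝓝 0) := by
    rw [← prod_atTop_atTop_eq]
    have := (h2.comp tendsto_fst).add (h2.comp (tendsto_snd (f := (atTop : Filter ℕ))))
    rw [add_zero] at this
    refine tendsto_of_tendsto_of_tendsto_of_le_of_le tendsto_const_nhds this
      (fun _ => zero_le) fun q => ?_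
    refine le_trans (le_of_eq ?_) (eLpNorm_sub_le
      ((v q.1).continuous.aestronglyMeasurable.sub hF)
      ((v q.2).continuous.aestronglyMeasurable.sub hF) (by norm_num))
    congr 1
    ext x
    simp only [_root_.sub_apply, Pi.sub_apply]
    ring
  have hd' : ∀ p : ℝ≥0∞, 1 ≤ p → p ≠ ∞ → Tendsto (fun q : ℕ × ℕ =>
      eLpNorm (fun φ => pairing (v q.1) φ - pairing (v q.2) φ) p μ) atTop (𝓝 0) := by
    intro p hp hp'
    have := tendsto_eLpNorm_pairing (μ := μ) hE (u := fun q : ℕ × ℕ => v q.1 - v q.2) (b := 2)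
      (fun q x => ?_) hd hp hp'
    · simpa only [pairing_sub] using this
    · have e : (v q.1 - v q.2 : Test n) x = (v q.1 x - F x) - (v q.2 x - F x) := by
        simp only [_root_.sub_apply]; ring
      rw [e]
      exact (norm_sub_le _ _).trans (by linarith [hv q.1 x, hv q.2 x])
  have hcau : CauchySeq fun k => (hmem k).toLp := by
    rw [Lp.cauchySeq_Lp_iff_cauchySeq_eLpNorm]
    refine (hd' 2 (by norm_num) ENNReal.ofNat_ne_top).congr fun q => eLpNorm_congr_ae ?_
    filter_upwards [(hmem q.1).coeFn_toLp, (hmem q.2).coeFn_toLp] with φ h1 h2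
    simp only [Pi.sub_apply, h1, h2]
  -- The `L²`-limit is also the limit in every `L^p`: along an almost surely convergent subsequence,
  -- Fatou's lemma bounds the distance to the limit by the `L^p`-distances between its members.
  obtain ⟨X, hX⟩ := cauchySeq_tendsto_of_complete hcau
  obtain ⟨ns, hns, hae⟩ := (tendstoInMeasure_of_tendsto_Lp hX).exists_seq_tendsto_ae
  have hae' : ∀ᵐ φ ∂μ, Tendsto (fun i => pairing (v (ns i)) φ) atTop (𝓝 (X φ)) := by
    filter_upwards [hae, ae_all_iff.2 fun i => (hmem (ns i)).coeFn_toLp] with φ h1 h2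
    exact h1.congr h2
  refine ⟨X, fun i => v (ns i), fun p hp hp' => ⟨?_, ?_⟩⟩
  · exact (tendsto_eLpNorm_of_norm_le_one hv h2 hp hp').comp hns.tendsto_atTop
  · rw [ENNReal.tendsto_atTop_zero]
    intro ε hε
    obtain ⟨N, hN⟩ := ENNReal.tendsto_atTop_zero.1
      (hd' p (le_trans (by norm_num) hp) hp') ε hε
    refine ⟨N.1 + N.2, fun k hk => ?_⟩
    refine Lp.eLpNorm_le_of_ae_tendsto (u := atTop)
      (f := fun j φ => pairing (v (ns k)) φ - pairing (v (ns j)) φ) ?_ (fun j =>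
        (aestronglyMeasurable_pairing _).sub (aestronglyMeasurable_pairing _)) ?_
    · filter_upwards [eventually_ge_atTop (N.1 + N.2)] with j hj
      refine hN (ns k, ns j) ⟨?_, ?_⟩
      · have := hns.id_le k
        simp only [id] at this
        exact (show N.1 ≤ ns k by omega)
      · have := hns.id_le j
        simp only [id] at this
        exact (show N.2 ≤ ns j by omega)
    · filter_upwards [hae'] with φ h
      exact tendsto_const_nhds.sub h

end

/-! ### Square integrability of the symbol -/

/-- The singularity `s^(-2γ)` of the squared symbol along the mass shell, cut off at `s = 1`. -/
def shellSingularity (γ s : ℝ) : ℝ := (Set.Ioo (0 : ℝ) 1).indicator (fun s => s ^ (-(2 * γ))) s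

/-- The energy `(|2πξ|² + m²)^{1/2}` of the momentum `2πξ`, divided by `2π`. -/
def shellEnergy {n : ℕ} (m : ℝ) (ξ : Fin n → ℝ) : ℝ :=
  Real.sqrt ((∑ k, (2 * Real.pi * ξ k) ^ 2) + m ^ 2) / (2 * Real.pi)

theorem shellSingularity_nonneg (γ s : ℝ) : 0 ≤ shellSingularity γ s :=
  Set.indicator_nonneg (fun _ hx => Real.rpow_nonneg hx.1.le _) s

theorem measurable_shellSingularity (γ : ℝ) : Measurable (shellSingularity γ) :=
  Measurable.indicator (by fun_prop) measurableSet_Ioo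

theorem lintegral_shellSingularity_lt_top {γ : ℝ} (hγ : γ < 1 / 2) :
    ∫⁻ s, ENNReal.ofReal (shellSingularity γ s) < ∞ := by
  have h : IntegrableOn (fun s : ℝ => s ^ (-(2 * γ))) (Set.Ioo (0 : ℝ) 1) :=
    (intervalIntegral.integrableOn_Ioo_rpow_iff one_pos).2 (by linarith)
  have h2 : Integrable (shellSingularity γ) := (integrable_indicator_iff measurableSet_Ioo).2 h
  exact h2.lintegral_lt_top

theorem measurable_symbol {n : ℕ} (m γ : ℝ) : Measurable (symbol (n := n) m γ) := by
  unfold symbol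
  refine Measurable.ite (measurableSet_lt ?_ ?_) ?_ measurable_const <;> fun_prop

/-- With `ω` the energy, `τ² - ω² = (τ - ω)(τ + ω) ≥ m (τ - ω)` on the support of the symbol. -/
theorem symbol_sq_le {n : ℕ} {m γ : ℝ} (hm : 0 < m) (hγ : 0 < γ) (p : Spacetime n) :
    symbol m γ ((2 * Real.pi) • p) ^ 2 ≤
      m ^ (-(2 * γ)) * (shellSingularity γ (p 0 - shellEnergy m fun k => p k.succ) + 1) := by
  have hm' : 0 ≤ m ^ (-(2 * γ)) := Real.rpow_nonneg hm.le _
  have hrhs : 0 ≤ shellSingularity γ (p 0 - shellEnergy m fun k => p k.succ) + 1 :=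
    add_nonneg (shellSingularity_nonneg _ _) zero_le_one
  unfold symbol
  split_ifs with h
  swap
  · rw [zero_pow two_ne_zero]; positivity
  simp only [PiLp.smul_apply, smul_eq_mul] at h ⊢
  set Q : ℝ := (∑ k : Fin n, (2 * Real.pi * p k.succ) ^ 2) + m ^ 2 with hQ
  set ω := Real.sqrt Q with hω
  set s : ℝ := p 0 - shellEnergy m fun k => p k.succ with hs
  have hQ0 : 0 ≤ Q := by positivity
  have hωm : m ≤ ω := Real.le_sqrt_of_sq_le (by
    have : 0 ≤ ∑ k : Fin n, (2 * Real.pi * p k.succ) ^ 2 := by positivity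
    rw [hQ]
    linarith)
  have hpi : (1 : ℝ) ≤ 2 * Real.pi := by linarith [Real.two_le_pi]
  have hs' : 2 * Real.pi * s = 2 * Real.pi * p 0 - ω := by
    rw [hs, shellEnergy, mul_sub, mul_div_cancel₀ _ (by positivity)]
  have hspos : 0 < s := by
    have : 0 < 2 * Real.pi * s := by rw [hs']; linarith
    exact pos_of_mul_pos_right this (by positivity)
  have hlow : m * s ≤ (2 * Real.pi * p 0) ^ 2 - Q := by
    have h1 : Q = ω ^ 2 := (Real.sq_sqrt hQ0).symm
    have h2 : s ≤ 2 * Real.pi * p 0 - ω := by rw [← hs']; nlinarith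
    have h3 : m ≤ 2 * Real.pi * p 0 + ω := by linarith
    rw [h1, sq_sub_sq]
    exact mul_le_mul h3 h2 hspos.le (hm.le.trans h3)
  have hms : 0 < m * s := mul_pos hm hspos
  calc (((2 * Real.pi * p 0) ^ 2 - Q) ^ (-γ)) ^ 2
      = ((2 * Real.pi * p 0) ^ 2 - Q) ^ (-(2 * γ)) := by
        rw [← Real.rpow_natCast, ← Real.rpow_mul (hms.le.trans hlow)]
        congr 1; push_cast; ring
    _ ≤ (m * s) ^ (-(2 * γ)) := Real.rpow_le_rpow_of_nonpos hms hlow (by linarith)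
    _ = m ^ (-(2 * γ)) * s ^ (-(2 * γ)) := Real.mul_rpow hm.le hspos.le
    _ ≤ _ := by
        refine mul_le_mul_of_nonneg_left ?_ hm'
        rcases lt_or_ge s 1 with h1 | h1
        · rw [shellSingularity, Set.indicator_of_mem (Set.mem_Ioo.2 ⟨hspos, h1⟩)]
          linarith
        · have := Real.rpow_le_one_of_one_le_of_nonpos h1 (by linarith : -(2 * γ) ≤ 0)
          linarith [shellSingularity_nonneg γ s]

/-- The splitting of space-time into time and space preserves the volume. -/
theorem volume_preserving_time_space (n : ℕ) :
    MeasurePreserving (fun p : Spacetime n => (p 0, fun k : Fin n => p k.succ)) volume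
      (volume : Measure (ℝ × (Fin n → ℝ))) :=
  (volume_preserving_piFinSuccAbove (fun _ : Fin (n + 1) => ℝ) 0).comp
    (PiLp.volume_preserving_ofLp (Fin (n + 1)))

theorem measurable_shellEnergy {n : ℕ} (m : ℝ) : Measurable (shellEnergy (n := n) m) := by
  unfold shellEnergy; fun_prop

theorem norm_space_le {n : ℕ} (p : Spacetime n) : ‖fun k : Fin n => p k.succ‖ ≤ ‖p‖ :=
  (pi_norm_le_iff_of_nonneg (norm_nonneg _)).2 fun k => PiLp.norm_apply_le p k.succ

/-- The symbol is square integrable against a power weight: for fixed momentum the squared symbol has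
an integrable singularity in the energy, since `2γ < 1`. -/
theorem memLp_symbol_mul_weight {n : ℕ} {m γ : ℝ} (hm : 0 < m) (hγ : 0 < γ) (hγ' : γ < 1 / 2) :
    MemLp (fun p : Spacetime n =>
      symbol m γ ((2 * Real.pi) • p) * (1 + ‖p‖ ^ 2) ^ (-((n : ℝ) + 1))) 2 volume := by
  have hmeas : Measurable fun p : Spacetime n =>
      symbol m γ ((2 * Real.pi) • p) * (1 + ‖p‖ ^ 2) ^ (-((n : ℝ) + 1)) :=
    ((measurable_symbol m γ).comp (measurable_const_smul _)).mul (by fun_prop)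
  refine (memLp_two_iff_integrable_sq hmeas.aestronglyMeasurable).2 ?_
  refine (lintegral_ofReal_ne_top_iff_integrable (hmeas.pow_const 2).aestronglyMeasurable
    (Eventually.of_forall fun p => sq_nonneg _)).1 (ne_of_lt ?_)
  -- The squared weight is `(1 + |p|²)^(-a/2)`, with `a` larger than the dimensions `n` and `n + 1`.
  set a : ℝ := 4 * ((n : ℝ) + 1) with ha
  have hw : ∀ x : ℝ, ((1 + x ^ 2) ^ (-((n : ℝ) + 1))) ^ 2 = (1 + x ^ 2) ^ (-a / 2) := by
    intro x
    rw [← Real.rpow_natCast, ← Real.rpow_mul (by positivity)]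
    congr 1; push_cast; ring
  set S : Spacetime n → ℝ := fun p =>
    shellSingularity γ (p 0 - shellEnergy m fun k => p k.succ) with hS
  have hSm : Measurable fun p : ℝ × (Fin n → ℝ) => ENNReal.ofReal
      (shellSingularity γ (p.1 - shellEnergy m p.2)) * ENNReal.ofReal ((1 + ‖p.2‖ ^ 2) ^ (-a / 2)) :=
    (((measurable_shellSingularity γ).comp (measurable_fst.sub
      ((measurable_shellEnergy m).comp measurable_snd))).ennreal_ofReal).mul (by fun_prop)
  have hpt : ∀ p : Spacetime n,
      ENNReal.ofReal ((symbol m γ ((2 * Real.pi) • p) * (1 + ‖p‖ ^ 2) ^ (-((n : ℝ) + 1))) ^ 2)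
      ≤ ENNReal.ofReal (m ^ (-(2 * γ))) *
        (ENNReal.ofReal (S p) * ENNReal.ofReal ((1 + ‖fun k : Fin n => p k.succ‖ ^ 2) ^ (-a / 2))
          + ENNReal.ofReal ((1 + ‖p‖ ^ 2) ^ (-a / 2))) := by
    intro p
    have hS0 : 0 ≤ S p := shellSingularity_nonneg _ _
    rw [← ENNReal.ofReal_mul hS0, ← ENNReal.ofReal_add (by positivity) (by positivity),
      ← ENNReal.ofReal_mul (by positivity), mul_pow, hw]
    refine ENNReal.ofReal_le_ofReal ?_
    have h1 : (1 + ‖p‖ ^ 2) ^ (-a / 2) ≤ (1 + ‖fun k : Fin n => p k.succ‖ ^ 2) ^ (-a / 2) := by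
      refine Real.rpow_le_rpow_of_nonpos (by positivity) ?_ ?_
      · have := norm_space_le p
        gcongr
      · have : 0 ≤ a := by positivity
        linarith
    calc symbol m γ ((2 * Real.pi) • p) ^ 2 * (1 + ‖p‖ ^ 2) ^ (-a / 2)
        ≤ (m ^ (-(2 * γ)) * (S p + 1)) * (1 + ‖p‖ ^ 2) ^ (-a / 2) :=
          mul_le_mul_of_nonneg_right (symbol_sq_le hm hγ p) (by positivity)
      _ = m ^ (-(2 * γ)) * (S p * (1 + ‖p‖ ^ 2) ^ (-a / 2) + (1 + ‖p‖ ^ 2) ^ (-a / 2)) := by ring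
      _ ≤ _ := by gcongr
  refine (lintegral_mono hpt).trans_lt ?_
  rw [lintegral_const_mul' _ _ ENNReal.ofReal_ne_top]
  refine ENNReal.mul_lt_top ENNReal.ofReal_lt_top ?_
  rw [lintegral_add_right _ (by fun_prop)]
  refine ENNReal.add_lt_top.2 ⟨?_, ?_⟩
  · have := (volume_preserving_time_space n).lintegral_comp hSm
    simp only [hS]
    rw [this, Measure.volume_eq_prod, lintegral_prod_symm' _ hSm]
    have inner : ∀ ξ : Fin n → ℝ, ∫⁻ τ, ENNReal.ofReal (shellSingularity γ (τ - shellEnergy m ξ))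
        * ENNReal.ofReal ((1 + ‖ξ‖ ^ 2) ^ (-a / 2))
        = (∫⁻ τ, ENNReal.ofReal (shellSingularity γ τ)) *
          ENNReal.ofReal ((1 + ‖ξ‖ ^ 2) ^ (-a / 2)) := by
      intro ξ
      rw [lintegral_mul_const' _ _ ENNReal.ofReal_ne_top,
        lintegral_sub_right_eq_self (fun τ => ENNReal.ofReal (shellSingularity γ τ))]
    simp only [inner]
    rw [lintegral_const_mul' _ _ (lintegral_shellSingularity_lt_top hγ').ne]
    refine ENNReal.mul_lt_top (lintegral_shellSingularity_lt_top hγ') ?_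
    refine (integrable_rpow_neg_one_add_norm_sq ?_).lintegral_lt_top
    rw [Module.finrank_fin_fun]
    linarith [(Nat.cast_nonneg n : (0 : ℝ) ≤ n)]
  · refine (integrable_rpow_neg_one_add_norm_sq ?_).lintegral_lt_top
    rw [finrank_euclideanSpace_fin]
    push_cast
    linarith [(Nat.cast_nonneg n : (0 : ℝ) ≤ n)]

theorem memLp_weight (n : ℕ) :
    MemLp (fun p : Spacetime n => (1 + ‖p‖ ^ 2) ^ (-((n : ℝ) + 1))) 2 volume := by
  have hmeas : Measurable fun p : Spacetime n => (1 + ‖p‖ ^ 2) ^ (-((n : ℝ) + 1)) := by fun_prop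
  refine (memLp_two_iff_integrable_sq hmeas.aestronglyMeasurable).2 ?_
  have h := integrable_rpow_neg_one_add_norm_sq (E := Spacetime n) (μ := volume)
    (r := 4 * ((n : ℝ) + 1)) (by
      rw [finrank_euclideanSpace_fin]
      push_cast
      linarith [(Nat.cast_nonneg n : (0 : ℝ) ≤ n)])
  refine h.congr (Eventually.of_forall fun p => ?_)
  simp only
  rw [← Real.rpow_natCast ((1 + ‖p‖ ^ 2) ^ (-((n : ℝ) + 1))), ← Real.rpow_mul (by positivity)]
  congr 1; push_cast; ring

/-! ### Inverse Fourier transforms of weighted square integrable functions -/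

theorem exists_seq_test_tendsto {n : ℕ} {B : Spacetime n → ℂ} (hB : MemLp B 2 volume) :
    ∃ h : ℕ → Test n, Tendsto (fun k => eLpNorm (fun x => h k x - B x) 2 volume) atTop (𝓝 0) := by
  have hd := SchwartzMap.denseRange_toLpCLM (E := Spacetime n) (F := ℂ) (p := 2) (μ := volume)
    ENNReal.ofNat_ne_top
  obtain ⟨u, hu, hlim⟩ := mem_closure_iff_seq_limit.1 (hd hB.toLp)
  choose h hh using hu
  refine ⟨h, ?_⟩
  have h2 : Tendsto (fun k => ((h k).memLp 2 volume).toLp) atTop (𝓝 hB.toLp) := by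
    refine hlim.congr fun k => ?_
    rw [← hh k]
    rfl
  exact (Lp.tendsto_Lp_iff_tendsto_eLpNorm'' _ (fun k => (h k).memLp 2 volume) _ hB).1 h2

theorem integrable_exp_smul {n : ℕ} {G : Spacetime n → ℂ} (hG : Integrable G) (x : Spacetime n) :
    Integrable fun p : Spacetime n =>
      Complex.exp (↑(2 * Real.pi * inner ℝ p x) * Complex.I) • G p := by
  have hc : Continuous fun p : Spacetime n =>
    Complex.exp (↑(2 * Real.pi * inner ℝ p x) * Complex.I) := by fun_prop
  refine hG.norm.mono' (hc.aestronglyMeasurable.smul hG.1)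
    (Eventually.of_forall fun p => ?_)
  rw [norm_smul, Complex.norm_exp_ofReal_mul_I, one_mul]

theorem fourierInv_sub {n : ℕ} {G H : Spacetime n → ℂ} (hG : Integrable G) (hH : Integrable H)
    (x : Spacetime n) : 𝓕⁻ G x - 𝓕⁻ H x = 𝓕⁻ (fun p => G p - H p) x := by
  rw [Real.fourierInv_eq', Real.fourierInv_eq', Real.fourierInv_eq',
    ← integral_sub (integrable_exp_smul hG x) (integrable_exp_smul hH x)]
  simp only [smul_sub]

theorem enorm_fourierInv_le {n : ℕ} (G : Spacetime n → ℂ) (x : Spacetime n) :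
    ‖𝓕⁻ G x‖ₑ ≤ eLpNorm G 1 volume := by
  rw [Real.fourierInv_eq', eLpNorm_one_eq_lintegral_enorm]
  refine (enorm_integral_le_lintegral_enorm _).trans (le_of_eq (lintegral_congr fun p => ?_))
  rw [enorm_smul, ← ofReal_norm, Complex.norm_exp_ofReal_mul_I, ENNReal.ofReal_one, one_mul]

theorem continuous_fourierInv {n : ℕ} {G : Spacetime n → ℂ} (hG : Integrable G) :
    Continuous (𝓕⁻ G) :=
  VectorFourier.fourierIntegral_continuous Real.continuous_fourierChar
    (by exact (continuous_inner (𝕜 := ℝ) (E := Spacetime n)).neg) hG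

theorem eLpNorm_fourierInv_test {n : ℕ} (h : Test n) :
    eLpNorm (𝓕⁻ h : Test n) 2 volume = eLpNorm h 2 volume := by
  have h1 := SchwartzMap.norm_fourier_toL2_eq (𝓕⁻ h : Test n)
  rw [FourierTransform.fourier_fourierInv_eq, SchwartzMap.norm_toLp, SchwartzMap.norm_toLp] at h1
  exact ((ENNReal.toReal_eq_toReal_iff' (h.eLpNorm_lt_top 2 volume).ne
    (SchwartzMap.eLpNorm_lt_top _ 2 volume).ne).1 h1).symm

section

variable {n : ℕ} {w : Spacetime n → ℝ} {B : Spacetime n → ℂ}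

theorem eLpNorm_one_weight_smul_le (hw2 : MemLp w 2 volume) (hB : AEStronglyMeasurable B volume) :
    eLpNorm (fun x => w x • B x) 1 volume ≤ eLpNorm w 2 volume * eLpNorm B 2 volume :=
  eLpNorm_smul_le_mul_eLpNorm (p := 2) (q := 2) (r := 1) (f := B) (φ := w) hB hw2.1

theorem integrable_weight_smul (hw2 : MemLp w 2 volume) (hB : MemLp B 2 volume) :
    Integrable fun x => w x • B x := by
  rw [← memLp_one_iff_integrable]
  exact hB.smul hw2

theorem eLpNorm_two_weight_smul_le (hw1 : ∀ x, |w x| ≤ 1) (B : Spacetime n → ℂ) :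
    eLpNorm (fun x => w x • B x) 2 volume ≤ eLpNorm B 2 volume :=
  eLpNorm_mono fun x => by
    rw [norm_smul]
    exact mul_le_of_le_one_left (norm_nonneg _) (hw1 x)

/-- For a smooth weight `w ∈ L² ∩ L^∞` and `B ∈ L²`, the inverse Fourier transform of
`w B ∈ L¹ ∩ L²` is approximated in `L²` by test functions, with errors bounded by one. -/
theorem exists_seq_test_fourierInv (hw : Function.HasTemperateGrowth w) (hw2 : MemLp w 2 volume)
    (hw1 : ∀ x, |w x| ≤ 1) (hB : MemLp B 2 volume) :
    ∃ v : ℕ → Test n, (∀ k x, ‖v k x - 𝓕⁻ (fun p => w p • B p) x‖ ≤ 1) ∧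
      Tendsto (fun k => eLpNorm (fun x => v k x - 𝓕⁻ (fun p => w p • B p) x) 2 volume)
        atTop (𝓝 0) ∧
      Tendsto (fun k => eLpNorm (v k) 2 volume) atTop
        (𝓝 (eLpNorm (fun p => w p • B p) 2 volume)) := by
  -- If `h k → B` in `L²`, then `w h k → w B` both in `L¹` (Cauchy–Schwarz) and in `L²`.
  obtain ⟨h, hh⟩ := exists_seq_test_tendsto hB
  set G : Spacetime n → ℂ := fun p => w p • B p with hG
  have hGint : Integrable G := integrable_weight_smul hw2 hB
  set g : ℕ → Test n := fun k => SchwartzMap.smulLeftCLM ℂ w (h k) with hg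
  have hgx : ∀ k x, g k x = w x • h k x := fun k x => SchwartzMap.smulLeftCLM_apply_apply hw _ x
  have hgG : ∀ k, (fun x => g k x - G x) = fun x => w x • (h k x - B x) := by
    intro k; ext x; rw [hgx, smul_sub]
  have hmd : ∀ k, AEStronglyMeasurable (fun x => h k x - B x) volume := fun k =>
    (h k).continuous.aestronglyMeasurable.sub hB.1
  have h1 : Tendsto (fun k => eLpNorm (fun x => g k x - G x) 1 volume) atTop (𝓝 0) := by
    have := ENNReal.Tendsto.const_mul (a := eLpNorm w 2 volume) hh (Or.inr hw2.2.ne)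
    rw [mul_zero] at this
    refine tendsto_of_tendsto_of_tendsto_of_le_of_le tendsto_const_nhds this
      (fun _ => zero_le) fun k => ?_
    simp only
    rw [hgG]
    exact eLpNorm_one_weight_smul_le hw2 (hmd k)
  have h2 : Tendsto (fun k => eLpNorm (fun x => g k x - G x) 2 volume) atTop (𝓝 0) := by
    refine tendsto_of_tendsto_of_tendsto_of_le_of_le tendsto_const_nhds hh
      (fun _ => zero_le) fun k => ?_
    simp only
    rw [hgG]
    exact eLpNorm_two_weight_smul_le hw1 _
  set v : ℕ → Test n := fun k => 𝓕⁻ (g k) with hv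
  have hvx : ∀ k x, v k x = 𝓕⁻ (g k : Spacetime n → ℂ) x := fun k x =>
    congrFun (SchwartzMap.fourierInv_coe (g k)) x
  have hsup : ∀ k x, ‖v k x - 𝓕⁻ G x‖ₑ ≤ eLpNorm (fun x => g k x - G x) 1 volume := by
    intro k x
    rw [hvx, fourierInv_sub (g k).integrable hGint]
    exact enorm_fourierInv_le _ x
  have hpt : ∀ x, Tendsto (fun k => v k x) atTop (𝓝 (𝓕⁻ G x)) := by
    intro x
    rw [tendsto_iff_edist_tendsto_0]
    refine tendsto_of_tendsto_of_tendsto_of_le_of_le tendsto_const_nhds h1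
      (fun _ => zero_le) fun k => ?_
    rw [edist_eq_enorm_sub]
    exact hsup k x
  have hmg : ∀ k, AEStronglyMeasurable (fun x => g k x - G x) volume := fun k =>
    (g k).continuous.aestronglyMeasurable.sub hGint.1
  have hvv : ∀ k l, eLpNorm (fun x => v k x - v l x) 2 volume ≤
      eLpNorm (fun x => g k x - G x) 2 volume + eLpNorm (fun x => g l x - G x) 2 volume := by
    intro k l
    have e : (fun x => v k x - v l x) = (𝓕⁻ (g k - g l) : Test n) := by
      have := map_sub (FourierTransform.fourierInvCLM ℂ (Test n)) (g k) (g l)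
      simp only [FourierTransform.fourierInvCLM_apply] at this
      rw [this]
      rfl
    rw [e, eLpNorm_fourierInv_test]
    refine le_trans (le_of_eq ?_) (eLpNorm_sub_le (hmg k) (hmg l) (by norm_num))
    congr 1
    ext x
    simp
  -- Plancherel's theorem for `g k - g l` and Fatou's lemma as `l → ∞`.
  have hL2 : Tendsto (fun k => eLpNorm (fun x => v k x - 𝓕⁻ G x) 2 volume) atTop (𝓝 0) := by
    rw [ENNReal.tendsto_atTop_zero] at h2 ⊢
    intro ε hε
    obtain ⟨N, hN⟩ := h2 (ε / 2) (ENNReal.half_pos hε.ne')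
    refine ⟨N, fun k hk => ?_⟩
    refine Lp.eLpNorm_le_of_ae_tendsto (u := atTop) (f := fun l x => v k x - v l x) ?_ (fun l =>
      ((v k).continuous.sub (v l).continuous).aestronglyMeasurable)
      (Eventually.of_forall fun x => tendsto_const_nhds.sub (hpt x))
    filter_upwards [eventually_ge_atTop N] with l hl
    refine (hvv k l).trans ((add_le_add (hN k hk) (hN l hl)).trans (le_of_eq ?_))
    exact ENNReal.add_halves ε
  have hnorm : Tendsto (fun k => eLpNorm (v k) 2 volume) atTop (𝓝 (eLpNorm G 2 volume)) := by
    have hmem : MemLp G 2 volume :=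
      ⟨hGint.1, (eLpNorm_two_weight_smul_le hw1 B).trans_lt hB.2⟩
    have ht : Tendsto (fun k => ((g k).memLp 2 volume).toLp) atTop (𝓝 hmem.toLp) :=
      (Lp.tendsto_Lp_iff_tendsto_eLpNorm'' _ (fun k => (g k).memLp 2 volume) _ hmem).2 h2
    have := ht.enorm
    simp only [Lp.enorm_toLp] at this
    refine this.congr fun k => ?_
    exact (eLpNorm_fourierInv_test (g k)).symm
  obtain ⟨N, hN⟩ := (ENNReal.tendsto_atTop_zero.1 h1) 1 one_pos
  refine ⟨fun k => v (k + N), fun k x => ?_, hL2.comp (tendsto_add_atTop_nat N),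
    hnorm.comp (tendsto_add_atTop_nat N)⟩
  have := (hsup (k + N) x).trans (hN (k + N) (by omega))
  rw [← ofReal_norm] at this
  exact ENNReal.ofReal_le_one.1 this

theorem eLpNorm_fourierInv_weight_le (hw : Function.HasTemperateGrowth w) (hw2 : MemLp w 2 volume)
    (hw1 : ∀ x, |w x| ≤ 1) (hB : MemLp B 2 volume) :
    eLpNorm (𝓕⁻ fun p => w p • B p) 2 volume ≤ eLpNorm B 2 volume := by
  obtain ⟨v, -, h2, h3⟩ := exists_seq_test_fourierInv hw hw2 hw1 hB
  have hm : AEStronglyMeasurable (𝓕⁻ fun p => w p • B p) volume :=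
    (continuous_fourierInv (integrable_weight_smul hw2 hB)).aestronglyMeasurable
  have h4 := h3.add h2
  rw [add_zero] at h4
  refine (ge_of_tendsto h4 (Eventually.of_forall fun k => ?_)).trans
    (eLpNorm_two_weight_smul_le hw1 B)
  have e : (𝓕⁻ fun p => w p • B p) =
      (v k : Spacetime n → ℂ) - fun x => v k x - 𝓕⁻ (fun p => w p • B p) x := by
    ext x; simp
  conv_lhs => rw [e]
  exact eLpNorm_sub_le (v k).continuous.aestronglyMeasurable
    ((v k).continuous.aestronglyMeasurable.sub hm) (by norm_num)

end

/-! ### The pseudo-differential operators on test functions -/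

/-- The weight `(1 + |p|²)^(-(n+1))`, smooth, bounded by one, and square integrable on the space-time
of dimension `n + 1`. -/
def weight (n : ℕ) (p : Spacetime n) : ℝ := (1 + ‖p‖ ^ 2) ^ (-((n : ℝ) + 1))

theorem hasTemperateGrowth_weight (n : ℕ) : Function.HasTemperateGrowth (weight n) :=
  Function.hasTemperateGrowth_one_add_norm_sq_rpow (Spacetime n) _

theorem abs_weight_le_one {n : ℕ} (p : Spacetime n) : |weight n p| ≤ 1 := by
  rw [weight, abs_of_nonneg (by positivity)]
  refine Real.rpow_le_one_of_one_le_of_nonpos (by linarith [sq_nonneg ‖p‖]) ?_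
  linarith [(Nat.cast_nonneg n : (0 : ℝ) ≤ n)]

/-- The Fourier transform of a test function, divided by the square of the weight, as a continuous
linear map of test functions. -/
def weightedFourier (n : ℕ) : Test n →L[ℝ] Test n :=
  (SchwartzMap.smulLeftCLM ℂ fun p : Spacetime n => (1 + ‖p‖ ^ 2) ^ (2 * ((n : ℝ) + 1))).comp
    ((FourierTransform.fourierCLM ℂ (Test n)).restrictScalars ℝ)

theorem weightedFourier_apply {n : ℕ} (f : Test n) (p : Spacetime n) :
    weightedFourier n f p
      = ((1 + ‖p‖ ^ 2) ^ (2 * ((n : ℝ) + 1)) : ℝ) • 𝓕 (f : Spacetime n → ℂ) p := by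
  rw [weightedFourier, ContinuousLinearMap.comp_apply, SchwartzMap.smulLeftCLM_apply_apply
    (Function.hasTemperateGrowth_one_add_norm_sq_rpow (Spacetime n) _)]
  rfl

/-- The function `j · F f`, divided by the weight; it is still square integrable. -/
def multiplier {n : ℕ} (m γ : ℝ) (f : Test n) (p : Spacetime n) : ℂ :=
  (symbol m γ ((2 * Real.pi) • p) * weight n p) • weightedFourier n f p

theorem weight_smul_multiplier {n : ℕ} (m γ : ℝ) (f : Test n) (p : Spacetime n) :
    weight n p • multiplier m γ f p
      = (symbol m γ ((2 * Real.pi) • p) : ℂ) * 𝓕 (f : Spacetime n → ℂ) p := by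
  have h : weight n p * weight n p * (1 + ‖p‖ ^ 2) ^ (2 * ((n : ℝ) + 1)) = 1 := by
    rw [weight, ← Real.rpow_add (by positivity), ← Real.rpow_add (by positivity)]
    ring_nf
    exact Real.rpow_zero _
  have e : weight n p * (symbol m γ ((2 * Real.pi) • p) * weight n p) *
      (1 + ‖p‖ ^ 2) ^ (2 * ((n : ℝ) + 1)) = symbol m γ ((2 * Real.pi) • p) := by
    linear_combination symbol m γ ((2 * Real.pi) • p) * h
  rw [multiplier, weightedFourier_apply, smul_smul, smul_smul, e, Complex.real_smul]

theorem Jplus_eq {n : ℕ} (m γ : ℝ) (f : Test n) :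
    Jplus m γ f = 𝓕⁻ fun p => weight n p • multiplier m γ f p := by
  simp only [weight_smul_multiplier]
  rfl

theorem norm_multiplier_le {n : ℕ} (m γ : ℝ) (f : Test n) (p : Spacetime n) :
    ‖multiplier m γ f p‖ ≤ SchwartzMap.seminorm ℝ 0 0 (weightedFourier n f) *
      ‖symbol m γ ((2 * Real.pi) • p) * weight n p‖ := by
  rw [multiplier, norm_smul, mul_comm]
  gcongr
  exact SchwartzMap.norm_le_seminorm ℝ _ _

theorem conjTest_add {n : ℕ} (f g : Test n) : conjTest (f + g) = conjTest f + conjTest g :=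
  map_add _ f g

theorem conjTest_smul {n : ℕ} (c : ℂ) (f : Test n) : conjTest (c • f) = conj c • conjTest f := by
  ext x; simp [conjTest_apply]

theorem conjTest_conjTest {n : ℕ} (f : Test n) : conjTest (conjTest f) = f := by
  ext x; simp [conjTest_apply]

theorem conj_exp_ofReal_mul_I (θ : ℝ) :
    conj (Complex.exp (θ * Complex.I)) = Complex.exp ((-θ : ℝ) * Complex.I) := by
  rw [← Complex.exp_conj]
  simp

theorem fourierInv_star {n : ℕ} (G : Spacetime n → ℂ) : 𝓕⁻ (star G) = star (𝓕 G) := by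
  ext y
  rw [Pi.star_apply, Real.fourierInv_eq', Real.fourier_eq',
    ← starRingEnd_apply (∫ p : Spacetime n, _), ← integral_conj]
  refine integral_congr_ae (Eventually.of_forall fun p => ?_)
  simp only [smul_eq_mul, map_mul, conj_exp_ofReal_mul_I, Pi.star_apply, starRingEnd_apply (G p)]
  congr 4
  ring

theorem coe_conjTest {n : ℕ} (f : Test n) :
    (conjTest f : Spacetime n → ℂ) = star (f : Spacetime n → ℂ) := by
  ext x; exact conjTest_apply f x

/-- The kernel of `J⁻` is the complex conjugate of that of `J⁺`. -/
theorem Jminus_eq_star {n : ℕ} (m γ : ℝ) (f : Test n) :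
    Jminus m γ f = star (Jplus m γ (conjTest f)) := by
  have h1 : 𝓕 (conjTest f : Spacetime n → ℂ) = star (𝓕⁻ (f : Spacetime n → ℂ)) := by
    have := fourierInv_star (conjTest f : Spacetime n → ℂ)
    rw [coe_conjTest, star_star] at this
    rw [this, star_star, coe_conjTest]
  have h2 : (fun p : Spacetime n => (symbol m γ ((2 * Real.pi) • p) : ℂ) *
        𝓕 (conjTest f : Spacetime n → ℂ) p)
      = star fun p : Spacetime n => (symbol m γ ((2 * Real.pi) • p) : ℂ) *
        𝓕⁻ (f : Spacetime n → ℂ) p := by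
    ext p
    simp [h1]
  rw [Jplus, h2, fourierInv_star, star_star, Jminus]

section

variable {n : ℕ} {m γ : ℝ}

theorem memLp_multiplier (hm : 0 < m) (hγ : 0 < γ) (hγ' : γ < 1 / 2) (f : Test n) :
    MemLp (multiplier m γ f) 2 volume := by
  refine MemLp.of_le_mul (memLp_symbol_mul_weight (n := n) hm hγ hγ') ?_
    (Eventually.of_forall fun p => norm_multiplier_le m γ f p)
  exact (memLp_symbol_mul_weight hm hγ hγ').1.smul
    (weightedFourier n f).continuous.aestronglyMeasurable

theorem integrable_symbol_mul_fourier (hm : 0 < m) (hγ : 0 < γ) (hγ' : γ < 1 / 2) (f : Test n) :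
    Integrable fun p => (symbol m γ ((2 * Real.pi) • p) : ℂ) * 𝓕 (f : Spacetime n → ℂ) p := by
  have := integrable_weight_smul (memLp_weight n) (memLp_multiplier hm hγ hγ' f)
  exact this.congr (Eventually.of_forall fun p => weight_smul_multiplier m γ f p)

theorem integrable_symbol_mul_fourierInv (hm : 0 < m) (hγ : 0 < γ) (hγ' : γ < 1 / 2)
    (f : Test n) :
    Integrable fun p => (symbol m γ ((2 * Real.pi) • p) : ℂ) * 𝓕⁻ (f : Spacetime n → ℂ) p := by
  have h := (Complex.conjCLE : ℂ →L[ℝ] ℂ).integrable_comp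
    (integrable_symbol_mul_fourier hm hγ hγ' (conjTest f))
  refine h.congr (Eventually.of_forall fun p => ?_)
  have := congrFun (fourierInv_star (conjTest f : Spacetime n → ℂ)) p
  rw [coe_conjTest, star_star] at this
  simp only [this, coe_conjTest]
  simp

theorem continuous_Jplus (hm : 0 < m) (hγ : 0 < γ) (hγ' : γ < 1 / 2) (f : Test n) :
    Continuous (Jplus m γ f) :=
  continuous_fourierInv (integrable_symbol_mul_fourier hm hγ hγ' f)

theorem continuous_Jminus (hm : 0 < m) (hγ : 0 < γ) (hγ' : γ < 1 / 2) (f : Test n) :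
    Continuous (Jminus m γ f) := by
  rw [Jminus_eq_star]
  exact (continuous_Jplus hm hγ hγ' _).star

theorem Jplus_add (hm : 0 < m) (hγ : 0 < γ) (hγ' : γ < 1 / 2) (f g : Test n) :
    Jplus m γ (f + g) = Jplus m γ f + Jplus m γ g := by
  have e : 𝓕 ((f + g : Test n) : Spacetime n → ℂ)
      = 𝓕 (f : Spacetime n → ℂ) + 𝓕 (g : Spacetime n → ℂ) := by
    have := map_add (FourierTransform.fourierCLM ℂ (Test n)) f g
    exact congrArg (fun h : Test n => (h : Spacetime n → ℂ)) this
  ext y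
  rw [Pi.add_apply, Jplus, Jplus, Jplus, Real.fourierInv_eq', Real.fourierInv_eq',
    Real.fourierInv_eq', ← integral_add
      (integrable_exp_smul (integrable_symbol_mul_fourier hm hγ hγ' f) y)
      (integrable_exp_smul (integrable_symbol_mul_fourier hm hγ hγ' g) y)]
  simp only [e, Pi.add_apply, mul_add, smul_add]

theorem Jplus_smul (c : ℂ) (f : Test n) : Jplus m γ (c • f) = c • Jplus m γ f := by
  have e : 𝓕 ((c • f : Test n) : Spacetime n → ℂ) = c • 𝓕 (f : Spacetime n → ℂ) := by
    have := map_smul (FourierTransform.fourierCLM ℂ (Test n)) c f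
    exact congrArg (fun h : Test n => (h : Spacetime n → ℂ)) this
  ext y
  rw [Pi.smul_apply, Jplus, Jplus, Real.fourierInv_eq', Real.fourierInv_eq', ← integral_smul]
  refine integral_congr_ae (Eventually.of_forall fun p => ?_)
  simp only [e, Pi.smul_apply, smul_eq_mul]
  ring

theorem Jminus_add (hm : 0 < m) (hγ : 0 < γ) (hγ' : γ < 1 / 2) (f g : Test n) :
    Jminus m γ (f + g) = Jminus m γ f + Jminus m γ g := by
  rw [Jminus_eq_star, Jminus_eq_star, Jminus_eq_star, conjTest_add, Jplus_add hm hγ hγ', star_add]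

theorem Jminus_smul (c : ℂ) (f : Test n) : Jminus m γ (c • f) = c • Jminus m γ f := by
  rw [Jminus_eq_star, Jminus_eq_star, conjTest_smul, Jplus_smul, star_smul]
  simp

/-- The `L²`-bound that makes the fields continuous in mean square. -/
theorem eLpNorm_Jplus_le (hm : 0 < m) (hγ : 0 < γ) (hγ' : γ < 1 / 2) (f : Test n) :
    eLpNorm (Jplus m γ f) 2 volume ≤
      ENNReal.ofReal (SchwartzMap.seminorm ℝ 0 0 (weightedFourier n f)) *
      eLpNorm (fun p : Spacetime n => symbol m γ ((2 * Real.pi) • p) * weight n p) 2 volume := by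
  rw [Jplus_eq]
  refine (eLpNorm_fourierInv_weight_le (hasTemperateGrowth_weight n) (memLp_weight n)
    abs_weight_le_one (memLp_multiplier hm hγ hγ' f)).trans ?_
  exact eLpNorm_le_mul_eLpNorm_of_ae_le_mul
    (Eventually.of_forall fun p => norm_multiplier_le m γ f p) 2

theorem tendsto_eLpNorm_Jplus (hm : 0 < m) (hγ : 0 < γ) (hγ' : γ < 1 / 2) :
    Tendsto (fun f : Test n => eLpNorm (Jplus m γ f) 2 volume) (𝓝 0) (𝓝 0) := by
  have hc : Continuous fun f : Test n => SchwartzMap.seminorm ℝ 0 0 (weightedFourier n f) :=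
    ((schwartz_withSeminorms ℝ (Spacetime n) ℂ).continuous_seminorm (0, 0)).comp
      (weightedFourier n).continuous
  have h1 := (ENNReal.continuous_ofReal.comp hc).tendsto 0
  simp only [Function.comp_apply, map_zero, ENNReal.ofReal_zero] at h1
  have h2 := ENNReal.Tendsto.mul_const (b := eLpNorm (fun p : Spacetime n =>
    symbol m γ ((2 * Real.pi) • p) * weight n p) 2 volume) h1
      (Or.inr (memLp_symbol_mul_weight hm hγ hγ').2.ne)
  rw [zero_mul] at h2
  exact tendsto_of_tendsto_of_tendsto_of_le_of_le tendsto_const_nhds h2 (fun _ => zero_le)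
    fun f => eLpNorm_Jplus_le hm hγ hγ' f

theorem tendsto_eLpNorm_Jminus (hm : 0 < m) (hγ : 0 < γ) (hγ' : γ < 1 / 2) :
    Tendsto (fun f : Test n => eLpNorm (Jminus m γ f) 2 volume) (𝓝 0) (𝓝 0) := by
  have hc : Continuous fun f : Test n => conjTest f :=
    (SchwartzMap.postcompCLM (Complex.conjCLE : ℂ →L[ℝ] ℂ)).continuous
  have h0 : conjTest (0 : Test n) = 0 := map_zero _
  have h1 := (tendsto_eLpNorm_Jplus (n := n) hm hγ hγ').comp (h0 ▸ hc.tendsto 0)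
  refine h1.congr fun f => ?_
  rw [Function.comp_apply, Jminus_eq_star]
  exact eLpNorm_congr_norm_ae (Eventually.of_forall fun x => by simp)

/-! ### The operators with cosine and sine kernels -/

theorem integral_cos_mul (f : Test n) (y p : Spacetime n) :
    ∫ x, (Real.cos (2 * Real.pi * inner ℝ (x - y) p) : ℂ) * f x =
      (1 / 2 : ℂ) * (Complex.exp (↑(2 * Real.pi * inner ℝ p y) * Complex.I) *
          𝓕 (f : Spacetime n → ℂ) p
        + Complex.exp (↑(-2 * Real.pi * inner ℝ p y) * Complex.I) *
          𝓕⁻ (f : Spacetime n → ℂ) p) := by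
  have hi1 := integrable_exp_smul (f.integrable (μ := volume)) (-p)
  have hi2 := integrable_exp_smul (f.integrable (μ := volume)) p
  simp only [inner_neg_right, mul_neg] at hi1
  rw [Real.fourier_eq', Real.fourierInv_eq', ← integral_const_mul, ← integral_const_mul,
    ← integral_add, ← integral_const_mul]
  · refine integral_congr_ae (Eventually.of_forall fun x => ?_)
    simp only [smul_eq_mul]
    rw [← mul_assoc, ← mul_assoc, ← Complex.exp_add, ← Complex.exp_add, ← add_mul, ← mul_assoc]
    congr 1
    rw [Complex.ofReal_cos, Complex.cos, inner_sub_left, real_inner_comm p y, mul_add, add_comm]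
    push_cast
    ring_nf
  · refine Integrable.const_mul ?_ _
    simpa using hi1
  · exact hi2.const_mul _

theorem integral_sin_mul (f : Test n) (y p : Spacetime n) :
    ∫ x, (Real.sin (2 * Real.pi * inner ℝ (x - y) p) : ℂ) * f x =
      (Complex.I / 2 : ℂ) * (Complex.exp (↑(2 * Real.pi * inner ℝ p y) * Complex.I) *
          𝓕 (f : Spacetime n → ℂ) p
        - Complex.exp (↑(-2 * Real.pi * inner ℝ p y) * Complex.I) *
          𝓕⁻ (f : Spacetime n → ℂ) p) := by
  have hi1 := integrable_exp_smul (f.integrable (μ := volume)) (-p)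
  have hi2 := integrable_exp_smul (f.integrable (μ := volume)) p
  simp only [inner_neg_right, mul_neg] at hi1
  rw [Real.fourier_eq', Real.fourierInv_eq', ← integral_const_mul, ← integral_const_mul,
    ← integral_sub, ← integral_const_mul]
  · refine integral_congr_ae (Eventually.of_forall fun x => ?_)
    simp only [smul_eq_mul]
    rw [← mul_assoc, ← mul_assoc, ← Complex.exp_add, ← Complex.exp_add, ← sub_mul, ← mul_assoc]
    congr 1
    rw [Complex.ofReal_sin, Complex.sin, inner_sub_left, real_inner_comm p y]
    push_cast
    ring_nf
  · refine Integrable.const_mul ?_ _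
    simpa using hi1
  · exact hi2.const_mul _

theorem integrable_exp_neg_smul {G : Spacetime n → ℂ} (hG : Integrable G) (y : Spacetime n) :
    Integrable fun p : Spacetime n =>
      Complex.exp (↑(-2 * Real.pi * inner ℝ p y) * Complex.I) • G p := by
  simpa using integrable_exp_smul hG (-y)

theorem reJ_eq (hm : 0 < m) (hγ : 0 < γ) (hγ' : γ < 1 / 2) (f : Test n) :
    reJ m γ f = (1 / 2 : ℂ) • (Jplus m γ f + Jminus m γ f) := by
  ext y
  rw [Pi.smul_apply, Pi.add_apply, reJ, Jplus, Jminus, Real.fourierInv_eq', Real.fourier_eq',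
    ← integral_add (integrable_exp_smul (integrable_symbol_mul_fourier hm hγ hγ' f) y)
      (integrable_exp_neg_smul (integrable_symbol_mul_fourierInv hm hγ hγ' f) y),
    smul_eq_mul, ← integral_const_mul]
  refine integral_congr_ae (Eventually.of_forall fun p => ?_)
  simp only [integral_cos_mul, smul_eq_mul]
  ring

theorem imJ_eq (hm : 0 < m) (hγ : 0 < γ) (hγ' : γ < 1 / 2) (f : Test n) :
    imJ m γ f = (Complex.I / 2 : ℂ) • (Jplus m γ f + (-1 : ℂ) • Jminus m γ f) := by
  ext y
  rw [Pi.smul_apply, Pi.add_apply, Pi.smul_apply, neg_one_smul, ← sub_eq_add_neg, imJ, Jplus,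
    Jminus, Real.fourierInv_eq', Real.fourier_eq',
    ← integral_sub (integrable_exp_smul (integrable_symbol_mul_fourier hm hγ hγ' f) y)
      (integrable_exp_neg_smul (integrable_symbol_mul_fourierInv hm hγ hγ' f) y),
    smul_eq_mul, ← integral_const_mul]
  refine integral_congr_ae (Eventually.of_forall fun p => ?_)
  simp only [integral_sin_mul, smul_eq_mul]
  ring

end

/-! ### The fields as stochastic extensions -/

/-- The hypotheses of the theory: admissible parameters of the symbol, and a field with the moment
bounds provided by its characteristic functional. -/
structure FieldSetting {n : ℕ} (m γ : ℝ) (μ : Measure (RealDistribution n)) (K : ℝ) : Prop where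
  mass_pos : 0 < m
  exponent_pos : 0 < γ
  exponent_lt : γ < 1 / 2
  nonneg : 0 ≤ K
  entire : ∀ g, HasEntireExponent μ K g

section

variable {n : ℕ} {m γ : ℝ} {μ : Measure (RealDistribution n)} {K : ℝ}

theorem isStochasticExtension_extPairing {F : Spacetime n → ℂ}
    (h : ∃ X, IsStochasticExtension μ F X) : IsStochasticExtension μ F (extPairing μ F) := by
  rw [extPairing, dif_pos h]
  exact h.choose_spec

namespace FieldSetting

theorem measurable_Jplus (h : FieldSetting m γ μ K) (f : Test n) :
    AEStronglyMeasurable (Jplus m γ f) volume :=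
  (continuous_Jplus h.mass_pos h.exponent_pos h.exponent_lt f).aestronglyMeasurable

theorem measurable_Jminus (h : FieldSetting m γ μ K) (f : Test n) :
    AEStronglyMeasurable (Jminus m γ f) volume :=
  (continuous_Jminus h.mass_pos h.exponent_pos h.exponent_lt f).aestronglyMeasurable

theorem measurable_reJ (h : FieldSetting m γ μ K) (f : Test n) :
    AEStronglyMeasurable (reJ m γ f) volume := by
  rw [reJ_eq h.mass_pos h.exponent_pos h.exponent_lt]
  exact ((h.measurable_Jplus f).add (h.measurable_Jminus f)).const_smul _

theorem measurable_imJ (h : FieldSetting m γ μ K) (f : Test n) :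
    AEStronglyMeasurable (imJ m γ f) volume := by
  rw [imJ_eq h.mass_pos h.exponent_pos h.exponent_lt]
  exact ((h.measurable_Jplus f).add ((h.measurable_Jminus f).const_smul _)).const_smul _

variable [IsProbabilityMeasure μ]

theorem unique (h : FieldSetting m γ μ K) {F : Spacetime n → ℂ}
    (hF : AEStronglyMeasurable F volume) {X Y : RealDistribution n →ₘ[μ] ℂ}
    (hX : IsStochasticExtension μ F X) (hY : IsStochasticExtension μ F Y) : X = Y :=
  hX.unique h.nonneg h.entire hF hY

theorem psiPlus_spec (h : FieldSetting m γ μ K) (f : Test n) :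
    IsStochasticExtension μ (Jplus m γ f) (psiPlus m γ μ f) := by
  refine isStochasticExtension_extPairing ?_
  obtain ⟨v, hv, h2, -⟩ := exists_seq_test_fourierInv (hasTemperateGrowth_weight n)
    (memLp_weight n) abs_weight_le_one
    (memLp_multiplier h.mass_pos h.exponent_pos h.exponent_lt f)
  rw [← Jplus_eq] at hv h2
  exact exists_isStochasticExtension h.entire (h.measurable_Jplus f) hv h2

theorem star_psiPlus_spec (h : FieldSetting m γ μ K) (f : Test n) :
    IsStochasticExtension μ (Jminus m γ f) (star (psiPlus m γ μ (conjTest f))) := by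
  rw [Jminus_eq_star]
  exact (h.psiPlus_spec (conjTest f)).star

theorem psiMinus_spec (h : FieldSetting m γ μ K) (f : Test n) :
    IsStochasticExtension μ (Jminus m γ f) (psiMinus m γ μ f) :=
  isStochasticExtension_extPairing ⟨_, h.star_psiPlus_spec f⟩

/-- The two fields are conjugate to each other; this is the source of the symmetric operators. -/
theorem psiMinus_eq_star (h : FieldSetting m γ μ K) (f : Test n) :
    psiMinus m γ μ f = star (psiPlus m γ μ (conjTest f)) :=
  h.unique (h.measurable_Jminus f) (h.psiMinus_spec f) (h.star_psiPlus_spec f)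

theorem psiPlus_add (h : FieldSetting m γ μ K) (f g : Test n) :
    psiPlus m γ μ (f + g) = psiPlus m γ μ f + psiPlus m γ μ g := by
  refine h.unique (h.measurable_Jplus _) (h.psiPlus_spec _) ?_
  rw [Jplus_add h.mass_pos h.exponent_pos h.exponent_lt]
  exact (h.psiPlus_spec f).add (h.measurable_Jplus f) (h.measurable_Jplus g) (h.psiPlus_spec g)

theorem psiPlus_smul (h : FieldSetting m γ μ K) (c : ℂ) (f : Test n) :
    psiPlus m γ μ (c • f) = c • psiPlus m γ μ f := by
  refine h.unique (h.measurable_Jplus _) (h.psiPlus_spec _) ?_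
  rw [Jplus_smul]
  exact (h.psiPlus_spec f).smul c

theorem psiMinus_add (h : FieldSetting m γ μ K) (f g : Test n) :
    psiMinus m γ μ (f + g) = psiMinus m γ μ f + psiMinus m γ μ g := by
  refine h.unique (h.measurable_Jminus _) (h.psiMinus_spec _) ?_
  rw [Jminus_add h.mass_pos h.exponent_pos h.exponent_lt]
  exact (h.psiMinus_spec f).add (h.measurable_Jminus f) (h.measurable_Jminus g) (h.psiMinus_spec g)

theorem psiMinus_smul (h : FieldSetting m γ μ K) (c : ℂ) (f : Test n) :
    psiMinus m γ μ (c • f) = c • psiMinus m γ μ f := by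
  refine h.unique (h.measurable_Jminus _) (h.psiMinus_spec _) ?_
  rw [Jminus_smul]
  exact (h.psiMinus_spec f).smul c

theorem reJ_spec (h : FieldSetting m γ μ K) (f : Test n) :
    IsStochasticExtension μ (reJ m γ f) ((1 / 2 : ℂ) • psiCos m γ μ f) := by
  rw [reJ_eq h.mass_pos h.exponent_pos h.exponent_lt]
  exact ((h.psiPlus_spec f).add (h.measurable_Jplus f) (h.measurable_Jminus f)
    (h.psiMinus_spec f)).smul _

theorem imJ_spec (h : FieldSetting m γ μ K) (f : Test n) :
    IsStochasticExtension μ (imJ m γ f) ((1 / 2 : ℂ) • psiSin m γ μ f) := by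
  rw [imJ_eq h.mass_pos h.exponent_pos h.exponent_lt]
  have := ((h.psiPlus_spec f).add (h.measurable_Jplus f) ((h.measurable_Jminus f).const_smul _)
    ((h.psiMinus_spec f).smul (-1 : ℂ))).smul (Complex.I / 2)
  convert this using 1
  rw [psiSin]
  module

theorem psiCos_eq (h : FieldSetting m γ μ K) (f : Test n) :
    psiCos m γ μ f = (2 : ℂ) • reField m γ μ f := by
  have := h.unique (h.measurable_reJ f) (h.reJ_spec f)
    (isStochasticExtension_extPairing ⟨_, h.reJ_spec f⟩)
  rw [reField, ← this, smul_smul]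
  norm_num

theorem psiSin_eq (h : FieldSetting m γ μ K) (f : Test n) :
    psiSin m γ μ f = (2 : ℂ) • imField m γ μ f := by
  have := h.unique (h.measurable_imJ f) (h.imJ_spec f)
    (isStochasticExtension_extPairing ⟨_, h.imJ_spec f⟩)
  rw [imField, ← this, smul_smul]
  norm_num

/-- Linear combinations of `ψ⁺` and `ψ⁻` are generalized random fields. -/
theorem isRandomField (h : FieldSetting m γ μ K) (a b : ℂ) :
    IsRandomField fun f => a • psiPlus m γ μ f + b • psiMinus m γ μ f := by
  have hadd : ∀ f g : Test n, a • psiPlus m γ μ (f + g) + b • psiMinus m γ μ (f + g)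
      = (a • psiPlus m γ μ f + b • psiMinus m γ μ f)
        + (a • psiPlus m γ μ g + b • psiMinus m γ μ g) := by
    intro f g
    rw [h.psiPlus_add, h.psiMinus_add, smul_add, smul_add]
    abel
  refine ⟨hadd, fun c f => ?_, fun f => ?_⟩
  · simp only
    rw [h.psiPlus_smul, h.psiMinus_smul, smul_add, smul_comm c a, smul_comm c b]
  · have hsub : ∀ g : Test n, (a • psiPlus m γ μ g + b • psiMinus m γ μ g)
        - (a • psiPlus m γ μ f + b • psiMinus m γ μ f)
        = a • psiPlus m γ μ (g - f) + b • psiMinus m γ μ (g - f) := by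
      intro g
      have := hadd (g - f) f
      rw [sub_add_cancel] at this
      rw [this, add_sub_cancel_right]
    have hbound : ∀ u : Test n,
        eLpNorm (a • psiPlus m γ μ u + b • psiMinus m γ μ u : RealDistribution n →ₘ[μ] ℂ) 2 μ
        ≤ 2 * ENNReal.ofReal K * (‖a‖ₑ * eLpNorm (Jplus m γ u) 2 volume
          + ‖b‖ₑ * eLpNorm (Jminus m γ u) 2 volume) := by
      intro u
      have hs := ((h.psiPlus_spec u).smul a).add ((h.measurable_Jplus u).const_smul a)
        ((h.measurable_Jminus u).const_smul b) ((h.psiMinus_spec u).smul b)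
      refine (hs.eLpNorm_two_le h.nonneg h.entire (((h.measurable_Jplus u).const_smul a).add
        ((h.measurable_Jminus u).const_smul b))).trans ?_
      gcongr
      refine (eLpNorm_add_le ((h.measurable_Jplus u).const_smul a)
        ((h.measurable_Jminus u).const_smul b) (by norm_num)).trans ?_
      rw [eLpNorm_const_smul, eLpNorm_const_smul]
    have hC : 2 * ENNReal.ofReal K ≠ ∞ :=
      ENNReal.mul_ne_top ENNReal.ofNat_ne_top ENNReal.ofReal_ne_top
    have hlim : Tendsto (fun u : Test n => 2 * ENNReal.ofReal K *
        (‖a‖ₑ * eLpNorm (Jplus m γ u) 2 volume + ‖b‖ₑ * eLpNorm (Jminus m γ u) 2 volume))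
        (𝓝 0) (𝓝 0) := by
      have h1 := ENNReal.Tendsto.const_mul (a := ‖a‖ₑ) (tendsto_eLpNorm_Jplus (n := n) h.mass_pos
        h.exponent_pos h.exponent_lt) (Or.inr enorm_ne_top)
      have h2 := ENNReal.Tendsto.const_mul (a := ‖b‖ₑ) (tendsto_eLpNorm_Jminus (n := n) h.mass_pos
        h.exponent_pos h.exponent_lt) (Or.inr enorm_ne_top)
      have h3 := ENNReal.Tendsto.const_mul (h1.add h2) (Or.inr hC)
      simpa using h3
    have hshift : Tendsto (fun g : Test n => g - f) (𝓝 f) (𝓝 0) := by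
      have : Continuous fun g : Test n => g - f := continuous_id.sub continuous_const
      simpa using this.tendsto f
    refine tendsto_of_tendsto_of_tendsto_of_le_of_le tendsto_const_nhds (hlim.comp hshift)
      (fun _ => zero_le) fun g => ?_
    simp only [Function.comp_apply]
    rw [hsub]
    exact hbound (g - f)

end FieldSetting

end

/-! ### Polynomials in the fields and multiplication operators -/

section

variable {n : ℕ} {m γ : ℝ} {μ : Measure (RealDistribution n)}

theorem memLp_mul_of_forall {X Y : RealDistribution n →ₘ[μ] ℂ}
    (hX : ∀ p : ℝ≥0∞, p ≠ ∞ → MemLp X p μ) (hY : ∀ p : ℝ≥0∞, p ≠ ∞ → MemLp Y p μ) :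
    ∀ p : ℝ≥0∞, p ≠ ∞ → MemLp (X * Y : RealDistribution n →ₘ[μ] ℂ) p μ := by
  intro p hp
  have h2 : 2 * p ≠ ∞ := ENNReal.mul_ne_top ENNReal.ofNat_ne_top hp
  have : (2 * p).HolderTriple (2 * p) p := ⟨by
    rw [← two_mul, ENNReal.mul_inv (Or.inl two_ne_zero) (Or.inl ENNReal.ofNat_ne_top), ← mul_assoc,
      ENNReal.mul_inv_cancel two_ne_zero ENNReal.ofNat_ne_top, one_mul]⟩
  exact ((hY _ h2).mul (hX _ h2)).ae_eq (AEEqFun.coeFn_mul X Y).symm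

variable [IsProbabilityMeasure μ]

theorem memLp_const_of_forall (c : ℂ) :
    ∀ p : ℝ≥0∞, p ≠ ∞ → MemLp (AEEqFun.const (RealDistribution n) c : _ →ₘ[μ] ℂ) p μ :=
  fun _ _ => (memLp_const c).ae_eq (AEEqFun.coeFn_const _ c).symm

variable {K : ℝ}

theorem FieldSetting.memLp_psiPlus (h : FieldSetting m γ μ K) (f : Test n) (p : ℝ≥0∞)
    (hp : p ≠ ∞) : MemLp (psiPlus m γ μ f) p μ :=
  (h.psiPlus_spec f).memLp h.entire hp

theorem FieldSetting.memLp_psiMinus (h : FieldSetting m γ μ K) (f : Test n) (p : ℝ≥0∞)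
    (hp : p ≠ ∞) : MemLp (psiMinus m γ μ f) p μ :=
  (h.psiMinus_spec f).memLp h.entire hp

/-- Polynomials in the fields have all moments, by Hölder's inequality. -/
theorem FieldSetting.memLp_of_mem_polySpace (h : FieldSetting m γ μ K)
    {u : RealDistribution n →ₘ[μ] ℂ} (hu : u ∈ polySpace m γ μ) (p : ℝ≥0∞) (hp : p ≠ ∞) :
    MemLp u p μ := by
  have hadd : ∀ {x y : RealDistribution n →ₘ[μ] ℂ}, MemLp x p μ → MemLp y p μ →
      MemLp (x + y : RealDistribution n →ₘ[μ] ℂ) p μ := fun hx hy =>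
    (hx.add hy).ae_eq (AEEqFun.coeFn_add _ _).symm
  have hsmul : ∀ (q : ℝ≥0∞) (c : ℂ) {x : RealDistribution n →ₘ[μ] ℂ}, MemLp x q μ →
      MemLp (c • x : RealDistribution n →ₘ[μ] ℂ) q μ := fun q c _ hx =>
    (hx.const_smul c).ae_eq (AEEqFun.coeFn_smul c _).symm
  induction hu using Submodule.span_induction with
  | mem u hu =>
    obtain ⟨c₀, N, c, X, hX, rfl⟩ := hu
    refine hadd (memLp_const_of_forall c₀ p hp) ?_
    refine Finset.prod_induction (fun k => c k • X k)
      (fun Y : RealDistribution n →ₘ[μ] ℂ => ∀ p : ℝ≥0∞, p ≠ ∞ → MemLp Y p μ)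
      (fun _ _ => memLp_mul_of_forall) (memLp_const_of_forall 1) (fun k _ q hq => ?_) p hp
    refine hsmul q (c k) ?_
    obtain ⟨f, hf | hf⟩ := hX k <;> rw [hf]
    · exact h.memLp_psiPlus f q hq
    · exact h.memLp_psiMinus f q hq
  | zero => exact (memLp_const (0 : ℂ)).ae_eq AEEqFun.coeFn_zero.symm
  | add x y _ _ hx hy => exact hadd hx hy
  | smul c x _ hx => exact hsmul p c hx

end

section

variable {n : ℕ} {m γ : ℝ} {μ : Measure (RealDistribution n)}

theorem add_mul_aux (X Y u : RealDistribution n →ₘ[μ] ℂ) : (X + Y) * u = X * u + Y * u := by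
  rw [mul_comm, mul_add_aux, mul_comm u, mul_comm u]

theorem smul_mul_aux (c : ℂ) (X u : RealDistribution n →ₘ[μ] ℂ) : (c • X) * u = c • (X * u) := by
  rw [mul_comm, mul_smul_aux, mul_comm u]

theorem mul_const_eq_smul (X : RealDistribution n →ₘ[μ] ℂ) (c : ℂ) :
    X * AEEqFun.const (RealDistribution n) c = c • X := by
  apply AEEqFun.ext
  filter_upwards [AEEqFun.coeFn_mul X (AEEqFun.const (RealDistribution n) c),
    AEEqFun.coeFn_const (μ := μ) (RealDistribution n) c, AEEqFun.coeFn_smul c X] with φ h1 h2 h3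
  rw [h1, h3, Pi.mul_apply, h2, Pi.smul_apply, Function.const_apply, smul_eq_mul, mul_comm]

/-- The random variables that multiply polynomials in the fields into such polynomials. -/
def IsMultiplier (m γ : ℝ) (X : RealDistribution n →ₘ[μ] ℂ) : Prop :=
  ∀ u ∈ polySpace m γ μ, X * u ∈ polySpace m γ μ

theorem isMultiplier_of_generator {X : RealDistribution n →ₘ[μ] ℂ}
    (hX : ∃ f : Test n, X = psiPlus m γ μ f ∨ X = psiMinus m γ μ f) : IsMultiplier m γ X := by
  intro u hu
  have hzero : AEEqFun.const (RealDistribution n) (0 : ℂ) = (0 : RealDistribution n →ₘ[μ] ℂ) := rfl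
  induction hu using Submodule.span_induction with
  | mem u hu =>
    obtain ⟨c₀, N, c, Y, hY, rfl⟩ := hu
    rw [mul_add_aux, mul_const_eq_smul]
    refine add_mem (Submodule.subset_span ?_) (Submodule.subset_span ?_)
    · refine ⟨0, 1, fun _ => c₀, fun _ => X, fun _ => hX, ?_⟩
      rw [hzero, zero_add, Fin.prod_univ_one]
    · refine ⟨0, N + 1, Fin.cons 1 c, Fin.cons X Y, Fin.cases hX hY, ?_⟩
      rw [hzero, zero_add, Fin.prod_univ_succ]
      simp only [Fin.cons_zero, Fin.cons_succ, one_smul]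
  | zero =>
    have : X * (0 : RealDistribution n →ₘ[μ] ℂ) = 0 := by
      have := mul_const_eq_smul X 0
      rwa [hzero, zero_smul ℂ X] at this
    rw [this]
    exact zero_mem _
  | add x y _ _ hx hy => rw [mul_add_aux]; exact add_mem hx hy
  | smul c x _ hx => rw [mul_smul_aux]; exact Submodule.smul_mem _ c hx

theorem isMultiplier_psiPlus (f : Test n) : IsMultiplier m γ (psiPlus m γ μ f) :=
  isMultiplier_of_generator ⟨f, Or.inl rfl⟩

theorem isMultiplier_psiMinus (f : Test n) : IsMultiplier m γ (psiMinus m γ μ f) :=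
  isMultiplier_of_generator ⟨f, Or.inr rfl⟩

theorem IsMultiplier.add {X Y : RealDistribution n →ₘ[μ] ℂ} (hX : IsMultiplier m γ X)
    (hY : IsMultiplier m γ Y) : IsMultiplier m γ (X + Y) := fun u hu => by
  rw [add_mul_aux]; exact add_mem (hX u hu) (hY u hu)

theorem IsMultiplier.smul {X : RealDistribution n →ₘ[μ] ℂ} (hX : IsMultiplier m γ X) (c : ℂ) :
    IsMultiplier m γ (c • X) := fun u hu => by
  rw [smul_mul_aux]; exact Submodule.smul_mem _ c (hX u hu)

theorem IsMultiplier.sub {X Y : RealDistribution n →ₘ[μ] ℂ} (hX : IsMultiplier m γ X)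
    (hY : IsMultiplier m γ Y) : IsMultiplier m γ (X - Y) := by
  have := hX.add (hY.smul (-1))
  rwa [show X + (-1 : ℂ) • Y = X - Y by module] at this

variable {X Y : RealDistribution n →ₘ[μ] ℂ}

theorem mulDomain_eq (hD : ∀ u ∈ polySpace m γ μ, u ∈ Lp ℂ 2 μ) (hX : IsMultiplier m γ X) :
    mulDomain m γ μ X = fieldDomain m γ μ := by
  ext u
  refine ⟨fun hu => hu.1, fun hu => ⟨hu, ?_⟩⟩
  have hXu : X * lpIncl μ (u : Lp ℂ 2 μ) ∈ polySpace m γ μ := hX _ hu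
  exact ⟨⟨⟨_, hD _ hXu⟩, Submodule.le_topologicalClosure _ hXu⟩, rfl⟩

theorem lpIncl_mulOperator (u : (mulOperator m γ μ X).domain) :
    lpIncl μ (mulOperator m γ μ X u : Lp ℂ 2 μ)
      = X * lpIncl μ ((u : hilbert m γ μ) : Lp ℂ 2 μ) :=
  lpIncl_mulValue m γ μ X u

theorem actsOn_mulOperator (hD : ∀ u ∈ polySpace m γ μ, u ∈ Lp ℂ 2 μ) (hX : IsMultiplier m γ X) :
    ActsOn (fieldDomain m γ μ) (mulOperator m γ μ X) := by
  refine ⟨mulDomain_eq hD hX, fun u => ?_⟩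
  change lpIncl μ (mulOperator m γ μ X u : Lp ℂ 2 μ) ∈ polySpace m γ μ
  rw [lpIncl_mulOperator]
  exact hX _ u.2.1

theorem dense_fieldDomain : Dense (fieldDomain m γ μ : Set (hilbert m γ μ)) := by
  rw [Subtype.dense_iff]
  intro x hx
  refine closure_mono ?_ hx
  intro y hy
  exact ⟨⟨y, Submodule.le_topologicalClosure _ hy⟩, hy, rfl⟩

/-- Multiplication by a real random variable is symmetric. -/
theorem isSymmetricOperator_mulOperator (hD : ∀ u ∈ polySpace m γ μ, u ∈ Lp ℂ 2 μ)
    (hX : IsMultiplier m γ X) (hreal : star X = X) :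
    IsSymmetricOperator (mulOperator m γ μ X) := by
  constructor
  · rw [show (mulOperator m γ μ X).domain = fieldDomain m γ μ from mulDomain_eq hD hX]
    exact dense_fieldDomain
  · intro x y
    rw [Submodule.coe_inner, Submodule.coe_inner, L2.inner_def, L2.inner_def]
    have hval : ∀ z : (mulOperator m γ μ X).domain,
        ((mulOperator m γ μ X z : Lp ℂ 2 μ) : RealDistribution n → ℂ)
          =ᵐ[μ] fun φ => X φ * ((z : hilbert m γ μ) : Lp ℂ 2 μ) φ := by
      intro z
      have h1 : ((mulOperator m γ μ X z : Lp ℂ 2 μ) : RealDistribution n →ₘ[μ] ℂ)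
          = X * (((z : hilbert m γ μ) : Lp ℂ 2 μ) : RealDistribution n →ₘ[μ] ℂ) :=
        lpIncl_mulOperator z
      rw [h1]
      exact AEEqFun.coeFn_mul _ _
    have hre : ∀ᵐ φ ∂μ, conj (X φ) = X φ := by
      filter_upwards [AEEqFun.coeFn_star X] with φ h
      rw [hreal] at h
      exact h.symm
    refine integral_congr_ae ?_
    filter_upwards [hval x, hval y, hre] with φ hx hy h
    rw [hx, hy, RCLike.inner_apply, RCLike.inner_apply, map_mul, h]
    ring

theorem mulOperator_add (hD : ∀ u ∈ polySpace m γ μ, u ∈ Lp ℂ 2 μ) (hX : IsMultiplier m γ X)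
    (hY : IsMultiplier m γ Y) :
    mulOperator m γ μ (X + Y) = mulOperator m γ μ X + mulOperator m γ μ Y := by
  have e : (mulOperator m γ μ (X + Y)).domain = (mulOperator m γ μ X + mulOperator m γ μ Y).domain := by
    change mulDomain m γ μ (X + Y) = mulDomain m γ μ X ⊓ mulDomain m γ μ Y
    rw [mulDomain_eq hD hX, mulDomain_eq hD hY, mulDomain_eq hD (hX.add hY), inf_idem]
  refine LinearPMap.ext e fun x hx hx' => ?_
  apply Subtype.ext
  apply lpIncl_injective μ
  rw [lpIncl_mulOperator, LinearPMap.add_apply, Submodule.coe_add, map_add, lpIncl_mulOperator,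
    lpIncl_mulOperator, add_mul_aux]

theorem mulOperator_smul (hD : ∀ u ∈ polySpace m γ μ, u ∈ Lp ℂ 2 μ) (hX : IsMultiplier m γ X)
    (c : ℂ) : mulOperator m γ μ (c • X) = c • mulOperator m γ μ X := by
  have e : (mulOperator m γ μ (c • X)).domain = (c • mulOperator m γ μ X).domain := by
    change mulDomain m γ μ (c • X) = mulDomain m γ μ X
    rw [mulDomain_eq hD hX, mulDomain_eq hD (hX.smul c)]
  refine LinearPMap.ext e fun x hx hx' => ?_
  apply Subtype.ext
  apply lpIncl_injective μ
  rw [lpIncl_mulOperator, LinearPMap.smul_apply, Submodule.coe_smul, map_smul, lpIncl_mulOperator,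
    smul_mul_aux]

theorem star_add_star (X : RealDistribution n →ₘ[μ] ℂ) : star (X + star X) = X + star X := by
  apply AEEqFun.ext
  filter_upwards [AEEqFun.coeFn_star (X + star X), AEEqFun.coeFn_add X (star X),
    AEEqFun.coeFn_star X] with φ h1 h2 h3
  rw [h1, Pi.star_apply, h2, Pi.add_apply, h3, Pi.star_apply, star_add, star_star, add_comm]

theorem star_I_smul_sub_star (X : RealDistribution n →ₘ[μ] ℂ) :
    star (Complex.I • (X - star X)) = Complex.I • (X - star X) := by
  apply AEEqFun.ext
  filter_upwards [AEEqFun.coeFn_star (Complex.I • (X - star X)),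
    AEEqFun.coeFn_smul Complex.I (X - star X), AEEqFun.coeFn_sub X (star X),
    AEEqFun.coeFn_star X] with φ h1 h2 h3 h4
  rw [h1, Pi.star_apply, h2, Pi.smul_apply, h3, Pi.sub_apply, h4, Pi.star_apply, smul_eq_mul,
    star_mul, star_sub, star_star]
  simp only [RCLike.star_def, Complex.conj_I]
  ring

end

/-! ### The composed fields -/

section

variable {n : ℕ} {m γ : ℝ} {μ : Measure (RealDistribution n)} {K : ℝ}

theorem isMultiplier_psiCos (f : Test n) : IsMultiplier m γ (psiCos m γ μ f) :=
  (isMultiplier_psiPlus f).add (isMultiplier_psiMinus f)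

theorem isMultiplier_psiSin (f : Test n) : IsMultiplier m γ (psiSin m γ μ f) :=
  ((isMultiplier_psiPlus f).sub (isMultiplier_psiMinus f)).smul _

theorem isMultiplier_psiPM (f : Test n) : IsMultiplier m γ (psiPM m γ μ f) :=
  (isMultiplier_psiPlus f).add (isMultiplier_psiMinus _)

theorem isMultiplier_psiMP (f : Test n) : IsMultiplier m γ (psiMP m γ μ f) :=
  ((isMultiplier_psiPlus f).sub (isMultiplier_psiMinus _)).smul _

theorem conjTest_of_real {f : Test n} (hf : ∀ x, (f x).im = 0) : conjTest f = f := by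
  ext x
  rw [conjTest_apply]
  exact Complex.conj_eq_iff_im.2 (hf x)

variable [IsProbabilityMeasure μ]

namespace FieldSetting

theorem star_psiPM (h : FieldSetting m γ μ K) (f : Test n) :
    star (psiPM m γ μ f) = psiPM m γ μ f := by
  rw [psiPM, h.psiMinus_eq_star, conjTest_conjTest]
  exact star_add_star _

theorem star_psiMP (h : FieldSetting m γ μ K) (f : Test n) :
    star (psiMP m γ μ f) = psiMP m γ μ f := by
  rw [psiMP, h.psiMinus_eq_star, conjTest_conjTest]
  exact star_I_smul_sub_star _

theorem psiCos_add (h : FieldSetting m γ μ K) (f g : Test n) :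
    psiCos m γ μ (f + g) = psiCos m γ μ f + psiCos m γ μ g := by
  simp only [psiCos, h.psiPlus_add, h.psiMinus_add]
  abel

theorem psiCos_smul (h : FieldSetting m γ μ K) (c : ℂ) (f : Test n) :
    psiCos m γ μ (c • f) = c • psiCos m γ μ f := by
  simp only [psiCos, h.psiPlus_smul, h.psiMinus_smul, smul_add]

theorem psiSin_add (h : FieldSetting m γ μ K) (f g : Test n) :
    psiSin m γ μ (f + g) = psiSin m γ μ f + psiSin m γ μ g := by
  simp only [psiSin, h.psiPlus_add, h.psiMinus_add]
  module

theorem psiSin_smul (h : FieldSetting m γ μ K) (c : ℂ) (f : Test n) :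
    psiSin m γ μ (c • f) = c • psiSin m γ μ f := by
  simp only [psiSin, h.psiPlus_smul, h.psiMinus_smul]
  module

theorem psiPM_add (h : FieldSetting m γ μ K) (f g : Test n) :
    psiPM m γ μ (f + g) = psiPM m γ μ f + psiPM m γ μ g := by
  simp only [psiPM, conjTest_add, h.psiPlus_add, h.psiMinus_add]
  abel

theorem psiPM_smul (h : FieldSetting m γ μ K) (c : ℝ) (f : Test n) :
    psiPM m γ μ ((c : ℂ) • f) = (c : ℂ) • psiPM m γ μ f := by
  simp only [psiPM, conjTest_smul, Complex.conj_ofReal, h.psiPlus_smul, h.psiMinus_smul, smul_add]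

theorem psiMP_add (h : FieldSetting m γ μ K) (f g : Test n) :
    psiMP m γ μ (f + g) = psiMP m γ μ f + psiMP m γ μ g := by
  simp only [psiMP, conjTest_add, h.psiPlus_add, h.psiMinus_add]
  module

theorem psiMP_smul (h : FieldSetting m γ μ K) (c : ℝ) (f : Test n) :
    psiMP m γ μ ((c : ℂ) • f) = (c : ℂ) • psiMP m γ μ f := by
  simp only [psiMP, conjTest_smul, Complex.conj_ofReal, h.psiPlus_smul, h.psiMinus_smul]
  module

theorem isRandomField_psiCos (h : FieldSetting m γ μ K) : IsRandomField (psiCos m γ μ) := by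
  have := h.isRandomField 1 1
  simp only [one_smul] at this
  exact this

theorem isRandomField_psiSin (h : FieldSetting m γ μ K) : IsRandomField (psiSin m γ μ) := by
  have := h.isRandomField Complex.I (-Complex.I)
  convert this using 2 with f
  rw [psiSin]
  module

end FieldSetting

end

end LevyField

end

open LevyField in
theorem theorem2 (n : ℕ) (m γ : ℝ) (hm : 0 < m) (hγ : γ ∈ Set.Ioo (0 : ℝ) (1 / 2))
    (μ : Measure (RealDistribution n)) [IsProbabilityMeasure μ]
    (hμ : IsGaussianField μ ∨ ∃ M : Measure ℝ, IsAdmissibleLevyMeasure M ∧ IsLevyField M μ) :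
    -- the random variables and the polynomial space are well defined
    ((∀ f : Test n,
        (∃! X, IsStochasticExtension μ (Jplus m γ f) X) ∧
        (∃! X, IsStochasticExtension μ (Jminus m γ f) X) ∧
        (∃! X, IsStochasticExtension μ (reJ m γ f) X) ∧
        (∃! X, IsStochasticExtension μ (imJ m γ f) X)) ∧
      (∀ u ∈ polySpace m γ μ, u ∈ Lp ℂ 2 μ)) ∧
    -- i) the field `ψ^cos`
    (IsRandomField (psiCos m γ μ) ∧
      (∀ f : Test n, psiCos m γ μ f = (2 : ℂ) • reField m γ μ f) ∧
      (∀ f : Test n, ActsOn (fieldDomain m γ μ) (mulOperator m γ μ (psiCos m γ μ f))) ∧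
      (∀ f : Test n, (∀ x, (f x).im = 0) →
        IsSymmetricOperator (mulOperator m γ μ (psiCos m γ μ f))) ∧
      (∀ f g : Test n, mulOperator m γ μ (psiCos m γ μ (f + g))
        = mulOperator m γ μ (psiCos m γ μ f) + mulOperator m γ μ (psiCos m γ μ g)) ∧
      (∀ (c : ℂ) (f : Test n), mulOperator m γ μ (psiCos m γ μ (c • f))
        = c • mulOperator m γ μ (psiCos m γ μ f))) ∧
    -- ii) the field `ψ^sin`
    (IsRandomField (psiSin m γ μ) ∧
      (∀ f : Test n, psiSin m γ μ f = (2 : ℂ) • imField m γ μ f) ∧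
      (∀ f : Test n, ActsOn (fieldDomain m γ μ) (mulOperator m γ μ (psiSin m γ μ f))) ∧
      (∀ f : Test n, (∀ x, (f x).im = 0) →
        IsSymmetricOperator (mulOperator m γ μ (psiSin m γ μ f))) ∧
      (∀ f g : Test n, mulOperator m γ μ (psiSin m γ μ (f + g))
        = mulOperator m γ μ (psiSin m γ μ f) + mulOperator m γ μ (psiSin m γ μ g)) ∧
      (∀ (c : ℂ) (f : Test n), mulOperator m γ μ (psiSin m γ μ (c • f))
        = c • mulOperator m γ μ (psiSin m γ μ f))) ∧
    -- iii) the fields `ψ^±` and `ψ^∓`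
    ((∀ f : Test n, ActsOn (fieldDomain m γ μ) (mulOperator m γ μ (psiPM m γ μ f)) ∧
        IsSymmetricOperator (mulOperator m γ μ (psiPM m γ μ f))) ∧
      (∀ f g : Test n, mulOperator m γ μ (psiPM m γ μ (f + g))
        = mulOperator m γ μ (psiPM m γ μ f) + mulOperator m γ μ (psiPM m γ μ g)) ∧
      (∀ (c : ℝ) (f : Test n), mulOperator m γ μ (psiPM m γ μ ((c : ℂ) • f))
        = (c : ℂ) • mulOperator m γ μ (psiPM m γ μ f)) ∧
      (∀ f : Test n, ActsOn (fieldDomain m γ μ) (mulOperator m γ μ (psiMP m γ μ f)) ∧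
        IsSymmetricOperator (mulOperator m γ μ (psiMP m γ μ f))) ∧
      (∀ f g : Test n, mulOperator m γ μ (psiMP m γ μ (f + g))
        = mulOperator m γ μ (psiMP m γ μ f) + mulOperator m γ μ (psiMP m γ μ g)) ∧
      (∀ (c : ℝ) (f : Test n), mulOperator m γ μ (psiMP m γ μ ((c : ℂ) • f))
        = (c : ℂ) • mulOperator m γ μ (psiMP m γ μ f))) := by
  obtain ⟨K, hK, hE⟩ := exists_hasEntireExponent hμ
  have h : FieldSetting m γ μ K := ⟨hm, hγ.1, hγ.2, hK, hE⟩
  have hD : ∀ u ∈ polySpace m γ μ, u ∈ Lp ℂ 2 μ := fun u hu =>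
    Lp.mem_Lp_iff_memLp.2 (h.memLp_of_mem_polySpace hu 2 ENNReal.ofNat_ne_top)
  have hcos : ∀ f : Test n, (∀ x, (f x).im = 0) → psiCos m γ μ f = psiPM m γ μ f := fun f hf => by
    rw [psiPM, conjTest_of_real hf, psiCos]
  have hsin : ∀ f : Test n, (∀ x, (f x).im = 0) → psiSin m γ μ f = psiMP m γ μ f := fun f hf => by
    rw [psiMP, conjTest_of_real hf, psiSin]
  refine ⟨⟨fun f => ⟨?_, ?_, ?_, ?_⟩, hD⟩, ⟨?_, ?_, ?_, ?_, ?_, ?_⟩, ⟨?_, ?_, ?_, ?_, ?_, ?_⟩,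
    ?_, ?_, ?_, ?_, ?_, ?_⟩
  · exact ⟨_, h.psiPlus_spec f, fun Y hY => h.unique (h.measurable_Jplus f) hY (h.psiPlus_spec f)⟩
  · exact ⟨_, h.psiMinus_spec f,
      fun Y hY => h.unique (h.measurable_Jminus f) hY (h.psiMinus_spec f)⟩
  · exact ⟨_, h.reJ_spec f, fun Y hY => h.unique (h.measurable_reJ f) hY (h.reJ_spec f)⟩
  · exact ⟨_, h.imJ_spec f, fun Y hY => h.unique (h.measurable_imJ f) hY (h.imJ_spec f)⟩
  · exact h.isRandomField_psiCos
  · exact h.psiCos_eq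
  · exact fun f => actsOn_mulOperator hD (isMultiplier_psiCos f)
  · exact fun f hf => isSymmetricOperator_mulOperator hD (isMultiplier_psiCos f)
      (by rw [hcos f hf, h.star_psiPM])
  · intro f g
    rw [h.psiCos_add, mulOperator_add hD (isMultiplier_psiCos f) (isMultiplier_psiCos g)]
  · intro c f
    rw [h.psiCos_smul, mulOperator_smul hD (isMultiplier_psiCos f)]
  · exact h.isRandomField_psiSin
  · exact h.psiSin_eq
  · exact fun f => actsOn_mulOperator hD (isMultiplier_psiSin f)
  · exact fun f hf => isSymmetricOperator_mulOperator hD (isMultiplier_psiSin f)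
      (by rw [hsin f hf, h.star_psiMP])
  · intro f g
    rw [h.psiSin_add, mulOperator_add hD (isMultiplier_psiSin f) (isMultiplier_psiSin g)]
  · intro c f
    rw [h.psiSin_smul, mulOperator_smul hD (isMultiplier_psiSin f)]
  · exact fun f => ⟨actsOn_mulOperator hD (isMultiplier_psiPM f),
      isSymmetricOperator_mulOperator hD (isMultiplier_psiPM f) (h.star_psiPM f)⟩
  · intro f g
    rw [h.psiPM_add, mulOperator_add hD (isMultiplier_psiPM f) (isMultiplier_psiPM g)]
  · intro c f
    rw [h.psiPM_smul, mulOperator_smul hD (isMultiplier_psiPM f)]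
  · exact fun f => ⟨actsOn_mulOperator hD (isMultiplier_psiMP f),
      isSymmetricOperator_mulOperator hD (isMultiplier_psiMP f) (h.star_psiMP f)⟩
  · intro f g
    rw [h.psiMP_add, mulOperator_add hD (isMultiplier_psiMP f) (isMultiplier_psiMP g)]
  · intro c f
    rw [h.psiMP_smul, mulOperator_smul hD (isMultiplier_psiMP f)]
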